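/- **Setting.** Write $\mathbb H=\mathbb C\oplus\mathbb C j$, where $\mathbb C=\mathbb C_i=\mathbb R+\mathbb R i$, let $\Omega\subset\mathbb H$ be a symmetric slice domain, and put $V=\Omega\cap\mathbb C^+$ with $\mathbb C^+=\{v\in\mathbb C:\operatorname{Im}v>0\}$. Let $f(q)=\sum_{m=0}^n q^m a_m$ $(a_m\in\mathbb H)$ be a non-constant slice-regular polynomial on $\Omega$. Write $f(v)=g(v)+h(v)j$ for $v\in\Omega\cap\mathbb C$ and $\hat g(v)=\overline{g(\bar v)}$, $\hat h(v)=\overline{h(\bar v)}$. The twistor transform of $f$ is the curve $G_f:V\to \mathrm{Gr}_2(\mathbb C^4)$ that sends $v$ to the graph $\{(x,\Phi_f(v)x):x\in\mathbb C^2\}$ of $\Phi_f(v)=\begin{pmatrix} g(v)&-\hat h(v)\\ h(v)&\hat g(v)\end{pmatrix}$. Use the homogeneous coordinates $[\zeta_1:\dots:\zeta_6]$ on $\mathbb{CP}^5=\mathbb P(\Lambda^2\mathbb C^4)$ for the basis $e_3\wedge e_4,\,-e_2\wedge e_4,\,e_2\wedge e_3,\,e_1\wedge e_4,\,-e_1\wedge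 e_3,\,e_1\wedge e_2$. For a covector $0\ne z\in\mathbb C^6$ let $X_z$ be the hyperplane section of $\mathrm{Gr}_2(\mathbb C^4)\subset\mathbb{CP}^5$ (Plücker embedding) cut out by $\sum_k z_k\zeta_k=0$. The group $\mathrm{PGL}(2,\mathbb H)=\mathrm{GL}(2,\mathbb H)/\mathbb R^\times$ acts on $\mathbb{CP}^5$ through $\Lambda^2$, where $\mathrm{GL}(2,\mathbb H)$ is the group of those $T\in\mathrm{GL}(4,\mathbb C)$ that commute with $\mathbf j(Z_1,Z_2,Z_3,Z_4)=(-\overline Z_2,\overline Z_1,-\overline Z_4,\overline Z_3)$. Let $\kappa:\mathbb{CP}^5\to(\mathbb{CP}^5)^\vee$, $\kappa[z_1:\dots:z_6]=[z_6:-z_5:z_4:z_3:-z_2:z_1]$, and put $$A_-=\kappa\bigl(\mathrm{PGL}(2,\mathbb H)\cdot[1:0:0:0:0:-1]\bigr),\qquad A_{Q\setminus N}=\kappa\bigl(\mathrm{PGL}(2,\mathbb H)\cdot[-1:0:-i:i:0:1]\bigr),$$ $$A_{\mathrm{nd}}=\kappa\Bigl(\bigcup_{0<\lambda<1}\mathrm{PGL}(2,\mathbb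 H)\cdot[-1:0:-i\lambda:i\lambda:0:1]\Bigr).$$ Call $f$ *planar* if $G_f(V)\subset X_z$ for some $z\neq0$, and *$A$-planar* if $G_f(V)\subset X_z$ for some $[z]\in A$. Let $S_f=\operatorname{span}_{\mathbb R}\{a_1,\dots,a_n\}$, $r=\dim_{\mathbb R}S_f$, and let $\mathcal A_f$ be the complex vector space of $\mathbb R$-linear maps $\Lambda:\mathbb H\to\mathbb C$ with $\Lambda|_{S_f}=0$. Every $\mathbb R$-linear $\Lambda:\mathbb H\to\mathbb C$ is uniquely of the form $\Lambda(b+cj)=z_2c-z_3b+z_4\bar b+z_5\bar c$ $(b,c\in\mathbb C)$; put $z_{\Lambda,f}=(0,z_2,z_3,z_4,z_5,-\Lambda(a_0))$, $\Delta(\Lambda)=z_3z_4-z_2z_5$ and $\operatorname{rank}_{\mathbb R}\Lambda=\dim_{\mathbb R}\Lambda(\mathbb H)$. **Theorem.** Let $f$ be a non-constant planar slice-regular polynomial. Then $r\le 3$, and the hyperplane sections containing $G_f$ are parametrized by $\mathbb P(\mathcal A_f)\cong\mathbb{CP}^{3-r}$. More precisely, $G_f(V)\subset X_{z_{\Lambda,f}}$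 for every $0\ne\Lambda\in\mathcal A_f$; the map $[\Lambda]\mapsto[z_{\Lambda,f}]$ is a bijection from $\mathbb P(\mathcal A_f)$ onto the set of $[z]\in(\mathbb{CP}^5)^\vee$ with $G_f(V)\subset X_z$; and $[\Lambda]\mapsto X_{z_{\Lambda,f}}$ is a bijection from $\mathbb P(\mathcal A_f)$ onto the set of hyperplane sections that contain $G_f(V)$. Moreover, for every $0\ne\Lambda\in\mathcal A_f$: 1. if $\operatorname{rank}_{\mathbb R}\Lambda=1$, then $[z_{\Lambda,f}]\in A_-$, so $f$ is $A_-$-planar; 2. if $\operatorname{rank}_{\mathbb R}\Lambda=2$ and $\Delta(\Lambda)=0$, then $[z_{\Lambda,f}]\in A_{Q\setminus N}$, so $f$ is $A_{Q\setminus N}$-planar; 3. if $\operatorname{rank}_{\mathbb R}\Lambda=2$ and $\Delta(\Lambda)\ne0$, then $[z_{\Lambda,f}]\in A_{\mathrm{nd}}$, so $f$ is $A_{\mathrm{nd}}$-planar. -/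

import Mathlib

open scoped LinearAlgebra.Projectivization Quaternion

namespace TwistorPoly

noncomputable section

/-! ### Bivectors of `ℂ⁴` in coordinates, and the Pluecker embedding

`Fin 6 → ℂ` is `⋀² ℂ⁴` with respect to the basis
`E₁ = e₃∧e₄, E₂ = -e₂∧e₄, E₃ = e₂∧e₃, E₄ = e₁∧e₄, E₅ = -e₁∧e₃, E₆ = e₁∧e₂`
(indices are shifted by one in the code). -/

/-- The coordinates of `u ∧ v` in the basis `E₁, …, E₆`. -/
def wedge (u v : Fin 4 → ℂ) : Fin 6 → ℂ :=
  ![u 2 * v 3 - u 3 * v 2,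
    -(u 1 * v 3 - u 3 * v 1),
    u 1 * v 2 - u 2 * v 1,
    u 0 * v 3 - u 3 * v 0,
    -(u 0 * v 2 - u 2 * v 0),
    u 0 * v 1 - u 1 * v 0]

theorem wedge_eq_zero {u v : Fin 4 → ℂ} (hw : wedge u v = 0) (k l : Fin 4) :
    u k * v l = u l * v k := by
  have e : ∀ k, wedge u v k = 0 := fun k => by rw [hw]; rfl
  have e0 : u 2 * v 3 - u 3 * v 2 = 0 := e 0
  have e1 : -(u 1 * v 3 - u 3 * v 1) = 0 := e 1
  have e2 : u 1 * v 2 - u 2 * v 1 = 0 := e 2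
  have e3 : u 0 * v 3 - u 3 * v 0 = 0 := e 3
  have e4 : -(u 0 * v 2 - u 2 * v 0) = 0 := e 4
  have e5 : u 0 * v 1 - u 1 * v 0 = 0 := e 5
  fin_cases k <;> fin_cases l <;> simp <;> grind

theorem wedge_ne_zero {u v : Fin 4 → ℂ} (h : LinearIndependent ℂ ![u, v]) :
    wedge u v ≠ 0 := by
  intro hw
  rw [LinearIndependent.pair_iff] at h
  have key : ∀ k, v k = 0 := by
    intro k
    refine (h (v k) (-(u k)) ?_).1
    funext l
    have := wedge_eq_zero hw k l
    simp only [Pi.add_apply, Pi.smul_apply, smul_eq_mul, Pi.zero_apply]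
    linear_combination -this
  have := (h 0 1 (by funext l; simp [key])).2
  exact one_ne_zero this

theorem wedge_combination (u v : Fin 4 → ℂ) (a b c d : ℂ) :
    wedge (a • u + b • v) (c • u + d • v) = (a * d - b * c) • wedge u v := by
  funext k
  fin_cases k <;> simp [wedge] <;> ring

/-- The Grassmannian `Gr₂(ℂ⁴)` of complex planes in `ℂ⁴`. -/
abbrev Gr : Type := {L : Submodule ℂ (Fin 4 → ℂ) // Module.finrank ℂ L = 2}

/-- A basis of the plane `L`. -/
def planeBasis (L : Gr) : Module.Basis (Fin 2) ℂ L.1 :=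
  Module.finBasisOfFinrankEq ℂ L.1 L.2

theorem planeBasis_linearIndependent (L : Gr) :
    LinearIndependent ℂ ![(planeBasis L 0 : Fin 4 → ℂ), (planeBasis L 1 : Fin 4 → ℂ)] := by
  have h := (planeBasis L).linearIndependent.map' L.1.subtype (Submodule.ker_subtype _)
  have e : (L.1.subtype ∘ planeBasis L) =
      ![(planeBasis L 0 : Fin 4 → ℂ), (planeBasis L 1 : Fin 4 → ℂ)] := by
    funext k
    fin_cases k <;> rfl
  rwa [e] at h

/-- The Pluecker embedding `Gr₂(ℂ⁴) → ℂℙ⁵`, `span {v₁, v₂} ↦ [v₁ ∧ v₂]`. -/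
def plucker (L : Gr) : ℙ ℂ (Fin 6 → ℂ) :=
  Projectivization.mk ℂ (wedge (planeBasis L 0) (planeBasis L 1))
    (wedge_ne_zero (planeBasis_linearIndependent L))

/-- The Pluecker point does not depend on the chosen basis. -/
theorem plucker_eq (L : Gr) {u v : Fin 4 → ℂ} (hu : u ∈ L.1) (hv : v ∈ L.1)
    (h : LinearIndependent ℂ ![u, v]) :
    plucker L = Projectivization.mk ℂ (wedge u v) (wedge_ne_zero h) := by
  have repr : ∀ w ∈ L.1, ∃ a b : ℂ,
      w = a • (planeBasis L 0 : Fin 4 → ℂ) + b • (planeBasis L 1 : Fin 4 → ℂ) := by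
    intro w hw
    have := (planeBasis L).sum_repr ⟨w, hw⟩
    rw [Fin.sum_univ_two] at this
    exact ⟨_, _, (congrArg Subtype.val this).symm⟩
  obtain ⟨a, b, rfl⟩ := repr u hu
  obtain ⟨c, d, rfl⟩ := repr v hv
  symm
  rw [plucker, Projectivization.mk_eq_mk_iff']
  exact ⟨_, (wedge_combination _ _ a b c d).symm⟩

/-! ### The action of `GL(4, ℂ)` on bivectors, and the group `GL(2, ℍ)` -/

/-- The induced map `⋀² T`, determined by its values on the basis `E₁, …, E₆`. -/
def wedgeMap (T : Matrix (Fin 4) (Fin 4) ℂ) : (Fin 6 → ℂ) →ₗ[ℂ] (Fin 6 → ℂ) :=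
  Fintype.linearCombination ℂ
    ![wedge (T.col 2) (T.col 3),
      -wedge (T.col 1) (T.col 3),
      wedge (T.col 1) (T.col 2),
      wedge (T.col 0) (T.col 3),
      -wedge (T.col 0) (T.col 2),
      wedge (T.col 0) (T.col 1)]

theorem wedgeMap_apply (T : Matrix (Fin 4) (Fin 4) ℂ) (p : Fin 6 → ℂ) :
    wedgeMap T p =
      p 0 • wedge (T.col 2) (T.col 3) + p 1 • (-wedge (T.col 1) (T.col 3)) +
      p 2 • wedge (T.col 1) (T.col 2) + p 3 • wedge (T.col 0) (T.col 3) +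
      p 4 • (-wedge (T.col 0) (T.col 2)) + p 5 • wedge (T.col 0) (T.col 1) := by
  simp only [wedgeMap, Fintype.linearCombination_apply, Fin.sum_univ_six]
  rfl

theorem wedgeMap_wedge (T : Matrix (Fin 4) (Fin 4) ℂ) (u v : Fin 4 → ℂ) :
    wedgeMap T (wedge u v) = wedge (T.mulVec u) (T.mulVec v) := by
  rw [wedgeMap_apply]
  funext k
  fin_cases k <;>
    simp [wedge, Matrix.mulVec, dotProduct, Fin.sum_univ_four, Matrix.col] <;> ring

theorem col_mul (S T : Matrix (Fin 4) (Fin 4) ℂ) (k : Fin 4) :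
    (S * T).col k = S.mulVec (T.col k) := by
  funext l
  rfl

/-- `T ↦ ⋀² T` is multiplicative. -/
def wedgeHom : Matrix (Fin 4) (Fin 4) ℂ →* Module.End ℂ (Fin 6 → ℂ) where
  toFun := wedgeMap
  map_one' := by
    refine LinearMap.ext fun p => ?_
    rw [wedgeMap_apply]
    funext k
    fin_cases k <;> simp [wedge, Matrix.col]
  map_mul' S T := by
    refine LinearMap.ext fun p => ?_
    rw [Module.End.mul_apply, wedgeMap_apply T p]
    simp only [map_add, map_smul, map_neg, wedgeMap_wedge, ← col_mul]
    rw [wedgeMap_apply]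

/-- The antilinear map `𝐣` on `ℂ⁴ = ℍ²`. -/
def jMap (Z : Fin 4 → ℂ) : Fin 4 → ℂ :=
  ![-star (Z 1), star (Z 0), -star (Z 3), star (Z 2)]

/-- `GL(2, ℍ)`, as the group of those elements of `GL(4, ℂ)` that commute with `𝐣`. -/
def GL2H : Subgroup (GL (Fin 4) ℂ) where
  carrier := {T | ∀ Z, T.1.mulVec (jMap Z) = jMap (T.1.mulVec Z)}
  mul_mem' {S T} hS hT Z := by
    simp only [Set.mem_ofPred_eq] at hS hT
    simp only [Units.val_mul, ← Matrix.mulVec_mulVec, hT, hS]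
  one_mem' Z := by simp
  inv_mem' {T} hT Z := by
    simp only [Set.mem_ofPred_eq] at hT
    have h1 : ∀ W, T.1.mulVec ((T⁻¹).1.mulVec W) = W := fun W => by
      rw [Matrix.mulVec_mulVec, ← Units.val_mul, mul_inv_cancel]; simp
    have h2 : ∀ W, (T⁻¹).1.mulVec (T.1.mulVec W) = W := fun W => by
      rw [Matrix.mulVec_mulVec, ← Units.val_mul, inv_mul_cancel]; simp
    conv_lhs => rw [← h1 Z, ← hT, h2]

/-- The index in `ℂ⁴ = ℂ² ⊕ ℂ²` of the coordinate `b` of the summand `a`. -/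
def blockIdx (a b : Fin 2) : Fin 4 := !![0, 1; 2, 3] a b

/-- Equivalently, each `2 × 2` block of `T` has the form `!![z, -w̄; w, z̄]`, that is,
it represents a quaternion. -/
theorem mem_GL2H_iff (T : GL (Fin 4) ℂ) :
    T ∈ GL2H ↔ ∀ a b : Fin 2,
      T.1 (blockIdx a 0) (blockIdx b 1) =
        -star (T.1 (blockIdx a 1) (blockIdx b 0)) ∧
      T.1 (blockIdx a 1) (blockIdx b 1) =
        star (T.1 (blockIdx a 0) (blockIdx b 0)) := by
  have i00 : blockIdx 0 0 = 0 := rfl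
  have i01 : blockIdx 0 1 = 1 := rfl
  have i10 : blockIdx 1 0 = 2 := rfl
  have i11 : blockIdx 1 1 = 3 := rfl
  constructor
  · intro h
    have h0 := h (Pi.single 0 1)
    have h2 := h (Pi.single 2 1)
    have a0 := fun k => congrFun h0 k
    have a2 := fun k => congrFun h2 k
    simp [jMap, Matrix.mulVec, dotProduct, Fin.sum_univ_four, Fin.forall_fin_succ] at a0 a2
    simp [Fin.forall_fin_two, i00, i01, i10, i11]
    tauto
  · intro h Z
    simp [Fin.forall_fin_two, i00, i01, i10, i11] at h
    obtain ⟨⟨⟨p1, p2⟩, p3, p4⟩, ⟨p5, p6⟩, p7, p8⟩ := h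
    funext k
    fin_cases k <;>
      simp [jMap, Matrix.mulVec, dotProduct, Fin.sum_univ_four, p1, p2, p3, p4, p5, p6, p7, p8] <;>
      ring

/-- The group of projective transformations of `ℙ(⋀² ℂ⁴) = ℂℙ⁵` induced by `GL(2, ℍ)`, as linear
maps. Real scalars act trivially on `ℂℙ⁵`, so its orbits there are those of
`PGL(2, ℍ) = GL(2, ℍ) / ℝˣ`. -/
def actingGroup : Subgroup (LinearMap.GeneralLinearGroup ℂ (Fin 6 → ℂ)) :=
  GL2H.map (Units.map wedgeHom)

/-- The orbit `PGL(2, ℍ) · [p]` in `ℂℙ⁵`. -/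
def orbit (p : ℙ ℂ (Fin 6 → ℂ)) : Set (ℙ ℂ (Fin 6 → ℂ)) :=
  MulAction.orbit actingGroup p

/-! ### Hyperplane sections -/

/-- The hyperplane `Π_z = {[ζ] | z₁ζ₁ + ⋯ + z₆ζ₆ = 0}` of a covector `[z] ∈ (ℂℙ⁵)ᵛ`. -/
def hyperplane (z : ℙ ℂ (Fin 6 → ℂ)) : Set (ℙ ℂ (Fin 6 → ℂ)) :=
  {ζ | Projectivization.orthogonal z ζ}

/-- The hyperplane section `X_z = Gr₂(ℂ⁴) ∩ Π_z`. -/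
def hyperplaneSection (z : ℙ ℂ (Fin 6 → ℂ)) : Set Gr :=
  {L | plucker L ∈ hyperplane z}

/-- The polarity map, on vectors. -/
def kappaLin : (Fin 6 → ℂ) →ₗ[ℂ] (Fin 6 → ℂ) where
  toFun z := ![z 5, -z 4, z 3, z 2, -z 1, z 0]
  map_add' x y := by
    funext k
    fin_cases k <;> simp <;> ring
  map_smul' c x := by
    funext k
    fin_cases k <;> simp

theorem kappaLin_injective : Function.Injective kappaLin := by
  intro x y h
  have e := fun k => congrFun h k
  simp [kappaLin, Fin.forall_fin_succ] at e
  funext k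
  fin_cases k <;> simp <;> tauto

/-- The polarity map `κ : ℂℙ⁵ → (ℂℙ⁵)ᵛ`. -/
def kappa : ℙ ℂ (Fin 6 → ℂ) → ℙ ℂ (Fin 6 → ℂ) :=
  Projectivization.map kappaLin kappaLin_injective

/-- The vector `(-1, 0, -iλ, iλ, 0, 1)`. -/
def poleVec (l : ℝ) : Fin 6 → ℂ :=
  ![-1, 0, -(Complex.I * l), Complex.I * l, 0, 1]

theorem poleVec_ne_zero (l : ℝ) : poleVec l ≠ 0 := fun h =>
  one_ne_zero (congrFun h 5 : (1 : ℂ) = 0)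

/-- The vector `(1, 0, 0, 0, 0, -1)`. -/
def minusVec : Fin 6 → ℂ := ![1, 0, 0, 0, 0, -1]

theorem minusVec_ne_zero : minusVec ≠ 0 := fun h =>
  one_ne_zero (congrFun h 0 : (1 : ℂ) = 0)

/-- The real space-like hyperplane type `A₋`. -/
def AMinus : Set (ℙ ℂ (Fin 6 → ℂ)) :=
  kappa '' orbit (Projectivization.mk ℂ minusVec minusVec_ne_zero)

/-- The non-real isotropic (`Q ∖ N`-tangent) hyperplane type. -/
def AQN : Set (ℙ ℂ (Fin 6 → ℂ)) :=
  kappa '' orbit (Projectivization.mk ℂ (poleVec 1) (poleVec_ne_zero 1))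

/-- The non-real negative-definite hyperplane type (a union of orbits). -/
def ANd : Set (ℙ ℂ (Fin 6 → ℂ)) :=
  kappa '' ⋃ l ∈ Set.Ioo (0 : ℝ) 1, orbit (Projectivization.mk ℂ (poleVec l) (poleVec_ne_zero l))

/-! ### Twistor transforms -/

/-- The point `x + y I` of the slice `ℂ_I`. -/
def slicePoint (I : ℍ[ℝ]) (z : ℂ) : ℍ[ℝ] := (z.re : ℍ[ℝ]) + (z.im : ℍ[ℝ]) * I

/-- Symmetric slice domains in `ℍ`. -/
structure IsSymmetricSliceDomain (Ω : Set ℍ[ℝ]) : Prop where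
  isOpen : IsOpen Ω
  isConnected : IsConnected Ω
  meets_real : ∃ x : ℝ, (x : ℍ[ℝ]) ∈ Ω
  slice_connected : ∀ I : ℍ[ℝ], I * I = -1 → IsConnected (slicePoint I ⁻¹' Ω)
  symmetric : ∀ I J : ℍ[ℝ], I * I = -1 → J * J = -1 → ∀ z : ℂ,
    slicePoint I z ∈ Ω → slicePoint J z ∈ Ω

/-- `V = Ω ∩ ℂ⁺`, for the slice `ℂ = ℂ_i`. -/
def upperSlice (Ω : Set ℍ[ℝ]) : Set ℂ := {v | 0 < v.im ∧ (v : ℍ[ℝ]) ∈ Ω}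

/-- The imaginary unit `i`. -/
def qi : ℍ[ℝ] := ⟨0, 1, 0, 0⟩

/-- The imaginary unit `j`. -/
def qj : ℍ[ℝ] := ⟨0, 0, 1, 0⟩

/-- The imaginary unit `k = i j`. -/
def qk : ℍ[ℝ] := ⟨0, 0, 0, 1⟩

theorem qi_parts : qi.re = 0 ∧ qi.imI = 1 ∧ qi.imJ = 0 ∧ qi.imK = 0 := ⟨rfl, rfl, rfl, rfl⟩

theorem qj_parts : qj.re = 0 ∧ qj.imI = 0 ∧ qj.imJ = 1 ∧ qj.imK = 0 := ⟨rfl, rfl, rfl, rfl⟩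

theorem qk_parts : qk.re = 0 ∧ qk.imI = 0 ∧ qk.imJ = 0 ∧ qk.imK = 1 := ⟨rfl, rfl, rfl, rfl⟩

/-- `z` in the decomposition `q = z + w j`. -/
def fstC (q : ℍ[ℝ]) : ℂ := ⟨q.re, q.imI⟩

/-- `w` in the decomposition `q = z + w j`. -/
def sndC (q : ℍ[ℝ]) : ℂ := ⟨q.imJ, q.imK⟩

theorem fstC_add_sndC_mul_j (q : ℍ[ℝ]) :
    q = (fstC q : ℍ[ℝ]) + (sndC q : ℍ[ℝ]) * qj := by
  ext <;> simp [fstC, sndC, qj_parts]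

/-- The first splitting function `g` of `f`, where `f(v) = g(v) + h(v) j` on the slice `ℂ`. -/
def splitG (f : ℍ[ℝ] → ℍ[ℝ]) (v : ℂ) : ℂ := fstC (f v)

/-- The second splitting function `h` of `f`. -/
def splitH (f : ℍ[ℝ] → ℍ[ℝ]) (v : ℂ) : ℂ := sndC (f v)

/-- The reflection `â(v) = conj (a (conj v))`. -/
def hat (a : ℂ → ℂ) (v : ℂ) : ℂ := star (a (star v))

/-- The graph matrix `Φ_f`. -/
def graphMatrix (f : ℍ[ℝ] → ℍ[ℝ]) (v : ℂ) : Matrix (Fin 2) (Fin 2) ℂ :=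
  !![splitG f v, -hat (splitH f) v; splitH f v, hat (splitG f) v]

/-- `x ↦ (x, Φ x)` from `ℂ²` to `ℂ⁴ = ℂ² ⊕ ℂ²`. -/
def graphMap (Φ : Matrix (Fin 2) (Fin 2) ℂ) : (Fin 2 → ℂ) →ₗ[ℂ] (Fin 4 → ℂ) where
  toFun x := ![x 0, x 1, Φ 0 0 * x 0 + Φ 0 1 * x 1, Φ 1 0 * x 0 + Φ 1 1 * x 1]
  map_add' x y := by
    funext k
    fin_cases k <;> simp <;> ring
  map_smul' c x := by
    funext k
    fin_cases k <;> simp <;> ring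

theorem graphMap_injective (Φ : Matrix (Fin 2) (Fin 2) ℂ) :
    Function.Injective (graphMap Φ) := by
  intro x y h
  have e0 : x 0 = y 0 := congrFun h 0
  have e1 : x 1 = y 1 := congrFun h 1
  funext k
  fin_cases k
  · exact e0
  · exact e1

/-- The graph `L(Φ) = {(x, y) | y = Φ x}`, a point of `Gr₂(ℂ⁴)`. -/
def graphPlane (Φ : Matrix (Fin 2) (Fin 2) ℂ) : Gr :=
  ⟨LinearMap.range (graphMap Φ), by
    rw [LinearMap.finrank_range_of_inj (graphMap_injective Φ)]; simp⟩

/-- The twistor transform `G_f(v) = L(Φ_f(v))`, to be considered for `v ∈ V`. -/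
def twistor (f : ℍ[ℝ] → ℍ[ℝ]) (v : ℂ) : Gr := graphPlane (graphMatrix f v)

/-- The curve `G_f` on `V = Ω ∩ ℂ⁺` lies in the hyperplane section `X_z`. -/
def LiesIn (Ω : Set ℍ[ℝ]) (f : ℍ[ℝ] → ℍ[ℝ]) (z : ℙ ℂ (Fin 6 → ℂ)) : Prop :=
  twistor f '' upperSlice Ω ⊆ hyperplaneSection z

/-- `f : Ω → ℍ` is planar. -/
def IsPlanar (Ω : Set ℍ[ℝ]) (f : ℍ[ℝ] → ℍ[ℝ]) : Prop := ∃ z, LiesIn Ω f z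

/-- `f : Ω → ℍ` is `A`-planar. -/
def IsPlanarOfType (Ω : Set ℍ[ℝ]) (f : ℍ[ℝ] → ℍ[ℝ]) (A : Set (ℙ ℂ (Fin 6 → ℂ))) : Prop :=
  ∃ z ∈ A, LiesIn Ω f z

/-! ### Polynomials and the space `𝒜_f` -/

/-- The polynomial `f(q) = ∑_{m=0}^n q^m a_m`. -/
def slicePoly (n : ℕ) (a : ℕ → ℍ[ℝ]) (q : ℍ[ℝ]) : ℍ[ℝ] :=
  ∑ m ∈ Finset.range (n + 1), q ^ m * a m

/-- `S_f = span_ℝ {a₁, …, a_n}`. -/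
def coeffSpan (n : ℕ) (a : ℕ → ℍ[ℝ]) : Submodule ℝ ℍ[ℝ] :=
  Submodule.span ℝ (a '' Set.Icc 1 n)

/-- The complex vector space of `ℝ`-linear maps `Λ : ℍ → ℂ` vanishing on `S`. -/
def annihilator (S : Submodule ℝ ℍ[ℝ]) : Submodule ℂ (ℍ[ℝ] →ₗ[ℝ] ℂ) where
  carrier := {Λ | ∀ s ∈ S, Λ s = 0}
  add_mem' {x y} hx hy s hs := by simp [hx s hs, hy s hs]
  zero_mem' s _ := rfl
  smul_mem' c x hx s hs := by simp [hx s hs]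

/-- The coefficient `z₂` of `Λ(b + c j) = z₂ c - z₃ b + z₄ b̄ + z₅ c̄`. -/
def coef2 (Λ : ℍ[ℝ] →ₗ[ℝ] ℂ) : ℂ := (Λ qj - Complex.I * Λ qk) / 2

/-- The coefficient `z₃` of `Λ(b + c j) = z₂ c - z₃ b + z₄ b̄ + z₅ c̄`. -/
def coef3 (Λ : ℍ[ℝ] →ₗ[ℝ] ℂ) : ℂ := (-Λ 1 + Complex.I * Λ qi) / 2

/-- The coefficient `z₄` of `Λ(b + c j) = z₂ c - z₃ b + z₄ b̄ + z₅ c̄`. -/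
def coef4 (Λ : ℍ[ℝ] →ₗ[ℝ] ℂ) : ℂ := (Λ 1 + Complex.I * Λ qi) / 2

/-- The coefficient `z₅` of `Λ(b + c j) = z₂ c - z₃ b + z₄ b̄ + z₅ c̄`. -/
def coef5 (Λ : ℍ[ℝ] →ₗ[ℝ] ℂ) : ℂ := (Λ qj + Complex.I * Λ qk) / 2

theorem apply_eq_coef (Λ : ℍ[ℝ] →ₗ[ℝ] ℂ) (q : ℍ[ℝ]) :
    Λ q = coef2 Λ * sndC q - coef3 Λ * fstC q + coef4 Λ * star (fstC q)
      + coef5 Λ * star (sndC q) := by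
  have hq : q = q.re • (1 : ℍ[ℝ]) + q.imI • qi
      + q.imJ • qj + q.imK • qk := by
    ext <;> simp [qi_parts, qj_parts, qk_parts]
  have h1 : fstC q = q.re + q.imI * Complex.I := by
    apply Complex.ext <;> simp [fstC]
  have h2 : sndC q = q.imJ + q.imK * Complex.I := by
    apply Complex.ext <;> simp [sndC]
  have h3 : star (fstC q) = q.re - q.imI * Complex.I := by
    apply Complex.ext <;> simp [fstC]
  have h4 : star (sndC q) = q.imJ - q.imK * Complex.I := by
    apply Complex.ext <;> simp [sndC]
  have h5 : Λ q = q.re * Λ 1 + q.imI * Λ qi + q.imJ * Λ qj + q.imK * Λ qk := by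
    have := congrArg Λ hq
    simpa only [map_add, map_smul, Complex.real_smul] using this
  rw [h3, h4, h1, h2, h5]
  simp only [coef2, coef3, coef4, coef5]
  linear_combination ((q.imI : ℂ) * Λ qi + (q.imK : ℂ) * Λ qk) * Complex.I_sq

/-- `Δ(Λ) = z₃ z₄ - z₂ z₅`. -/
def Delta (Λ : ℍ[ℝ] →ₗ[ℝ] ℂ) : ℂ := coef3 Λ * coef4 Λ - coef2 Λ * coef5 Λ

/-- The covector `z_{Λ,f} = (0, z₂, z₃, z₄, z₅, -Λ(a₀))`, as a linear function of `Λ`. -/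
def covec (a₀ : ℍ[ℝ]) : (ℍ[ℝ] →ₗ[ℝ] ℂ) →ₗ[ℂ] (Fin 6 → ℂ) where
  toFun Λ := ![0, coef2 Λ, coef3 Λ, coef4 Λ, coef5 Λ, -Λ a₀]
  map_add' x y := by
    funext k
    fin_cases k <;> simp [coef2, coef3, coef4, coef5, LinearMap.add_apply] <;> ring
  map_smul' c x := by
    funext k
    fin_cases k <;> simp [coef2, coef3, coef4, coef5, LinearMap.smul_apply] <;> ring

theorem covec_injective (a₀ : ℍ[ℝ]) : Function.Injective (covec a₀) := by
  intro x y h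
  have h2 : coef2 x = coef2 y := congrFun h 1
  have h3 : coef3 x = coef3 y := congrFun h 2
  have h4 : coef4 x = coef4 y := congrFun h 3
  have h5 : coef5 x = coef5 y := congrFun h 4
  refine LinearMap.ext fun q => ?_
  rw [apply_eq_coef x, apply_eq_coef y, h2, h3, h4, h5]

/-- The class `[z_{Λ,f}] ∈ (ℂℙ⁵)ᵛ` of a non-zero `Λ`. -/
def covecClass (a₀ : ℍ[ℝ]) (Λ : ℍ[ℝ] →ₗ[ℝ] ℂ) (hΛ : Λ ≠ 0) : ℙ ℂ (Fin 6 → ℂ) :=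
  Projectivization.mk ℂ (covec a₀ Λ)
    (fun h => hΛ (covec_injective a₀ (h.trans (map_zero _).symm)))

/-- The map `[Λ] ↦ [z_{Λ,f}]` on the projective space of a space `𝒜` of maps `Λ`. -/
def covecMap (a₀ : ℍ[ℝ]) (𝒜 : Submodule ℂ (ℍ[ℝ] →ₗ[ℝ] ℂ)) :
    ℙ ℂ 𝒜 → ℙ ℂ (Fin 6 → ℂ) :=
  Projectivization.map ((covec a₀).comp 𝒜.subtype)
    ((covec_injective a₀).comp 𝒜.injective_subtype)

/-- Isomorphism of the projective spaces `ℙ(E)` and `ℙ(F)`: a bijection that is induced by a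
linear isomorphism. -/
def ProjIso (E F : Type*) [AddCommGroup E] [Module ℂ E] [AddCommGroup F] [Module ℂ F] : Prop :=
  ∃ e : ℙ ℂ E ≃ ℙ ℂ F, ∃ φ : E ≃ₗ[ℂ] F,
    ∀ p, e p = Projectivization.map φ.toLinearMap φ.injective p

end

end TwistorPoly

open TwistorPoly

namespace TwistorPoly

/-! ### Incidence of graphs of matrices and hyperplanes -/

/-! A graph has Plücker coordinates `(det Φ, Φ₁₀, -Φ₀₀, Φ₁₁, -Φ₀₁, 1)`, so `G_f` lies in `X_w`
exactly when `w₁(gĝ + hĥ) + w₂h - w₃g + w₄ĝ + w₅ĥ + w₆` vanishes on `V`. For a polynomial `f` this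
is a polynomial in `v`, and `V` is infinite, so all its coefficients vanish. If `a_N` is the last
non-zero coefficient, then `N ≥ 1` and the coefficient of degree `2N` is `w₁|a_N|²`, whence `w₁ =
0`. The rest is affine in the `a_m` and says that the map `Λ` with coefficients `w₂, …, w₅` kills
`a₁, …, a_n` and that `w₆ = -Λ(a₀)`. Thus the covectors are exactly the `z_{Λ,f}`
(`liesIn_slicePoly_iff`, `liesIn_iff_exists_covec`). Since `𝒜_f ≅ Hom_ℝ(ℍ/S_f, ℂ)` has complex
dimension `4 - r`, planarity forces `r ≤ 3`. Different covectors of this form cut different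
sections, because a non-constant affine function of `Φ` is determined up to scaling by its zero set
(`eq_of_hyperplaneSection_eq`).

For the types, `GL(2, ℍ)` acts on the pole `κ(z_{Λ,f})`. Translations remove `a₀`
(`sameOrbit_covec`), diagonal matrices replace `Λ` by `Λ(α ·)` (`sameOrbit_covec_comp_mulLeft`), and
complex scalars act trivially on `ℂℙ⁵`. Write `Λ = ⟨x,·⟩ + i⟨y,·⟩`; then `-4Δ(Λ) = |x|² - |y|² +
2i⟨x,y⟩`. A complex scalar makes this real and non-negative, so that `x ⟂ y` and `|y| ≤ |x|`. Taking
`α = x` gives a multiple of `Re q + iλ Re(uq)` with `λ = |y|/|x|` and an imaginary unit `u`. A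
Cayley transform carries the model pole `(-1, 0, -iλ, iλ, 0, 1)` to the pole of this normal form
(`sameOrbit_normalMap`). Rank 1 means `λ = 0`; in rank 2, `0 < λ ≤ 1`, and `λ = 1` exactly when
`Δ(Λ) = 0`. -/

/-- The Pluecker coordinates of the graph of `Φ`. -/
def graphWedge (Φ : Matrix (Fin 2) (Fin 2) ℂ) : Fin 6 → ℂ :=
  ![Φ.det, Φ 1 0, -Φ 0 0, Φ 1 1, -Φ 0 1, 1]

theorem graphWedge_ne_zero (Φ : Matrix (Fin 2) (Fin 2) ℂ) : graphWedge Φ ≠ 0 := fun h =>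
  one_ne_zero (congrFun h 5 : (1 : ℂ) = 0)

theorem plucker_graphPlane (Φ : Matrix (Fin 2) (Fin 2) ℂ) :
    plucker (graphPlane Φ) = Projectivization.mk ℂ (graphWedge Φ) (graphWedge_ne_zero Φ) := by
  have hli : LinearIndependent ℂ
      ![graphMap Φ (Pi.single 0 1), graphMap Φ (Pi.single 1 1)] := by
    rw [LinearIndependent.pair_iff]
    intro s t h
    have h0 := congrFun h 0
    have h1 := congrFun h 1
    simp [graphMap] at h0 h1
    exact ⟨h0, h1⟩
  rw [plucker_eq (graphPlane Φ) (LinearMap.mem_range_self _ _) (LinearMap.mem_range_self _ _) hli]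
  congr 1
  funext k
  fin_cases k <;> simp [wedge, graphMap, graphWedge, Matrix.det_fin_two]
  ring

theorem graphPlane_mem_hyperplaneSection {w : Fin 6 → ℂ} (hw : w ≠ 0)
    (Φ : Matrix (Fin 2) (Fin 2) ℂ) :
    graphPlane Φ ∈ hyperplaneSection (Projectivization.mk ℂ w hw) ↔
      w 0 * Φ.det + w 1 * Φ 1 0 - w 2 * Φ 0 0 + w 3 * Φ 1 1 - w 4 * Φ 0 1 + w 5 = 0 := by
  simp only [hyperplaneSection, hyperplane, Set.mem_ofPred_eq]
  rw [plucker_graphPlane, Projectivization.orthogonal_mk]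
  simp [dotProduct, Fin.sum_univ_six, graphWedge, sub_eq_add_neg]

/-- Covectors with vanishing first entry are determined up to scaling by their hyperplane
sections. -/
theorem eq_of_hyperplaneSection_eq {z w : Fin 6 → ℂ} (hz : z ≠ 0) (hw : w ≠ 0)
    (hz0 : z 0 = 0) (hw0 : w 0 = 0) (hlin : z 1 ≠ 0 ∨ z 2 ≠ 0 ∨ z 3 ≠ 0 ∨ z 4 ≠ 0)
    (h : hyperplaneSection (Projectivization.mk ℂ z hz) =
      hyperplaneSection (Projectivization.mk ℂ w hw)) :
    Projectivization.mk ℂ z hz = Projectivization.mk ℂ w hw := by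
  have key : ∀ A B C D : ℂ, z 1 * C - z 2 * A + z 3 * D - z 4 * B + z 5 = 0 →
      w 1 * C - w 2 * A + w 3 * D - w 4 * B + w 5 = 0 := by
    intro A B C D hA
    have := graphPlane_mem_hyperplaneSection hw !![A, B; C, D]
    rw [← h, graphPlane_mem_hyperplaneSection hz] at this
    simpa [hw0, hz0] using this.1 (by simpa [hz0] using hA)
  have fin : ∀ c : ℂ, (∀ A B C D : ℂ, w 1 * C - w 2 * A + w 3 * D - w 4 * B + w 5 =
      c * (z 1 * C - z 2 * A + z 3 * D - z 4 * B + z 5)) →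
      Projectivization.mk ℂ z hz = Projectivization.mk ℂ w hw := by
    intro c hc
    symm
    rw [Projectivization.mk_eq_mk_iff']
    refine ⟨c, ?_⟩
    have h0 := hc 0 0 0 0
    have hA := hc 1 0 0 0
    have hB := hc 0 1 0 0
    have hC := hc 0 0 1 0
    have hD := hc 0 0 0 1
    funext k
    fin_cases k <;> simp [hz0, hw0]
    · linear_combination h0 - hC
    · linear_combination hA - h0
    · linear_combination h0 - hD
    · linear_combination hB - h0
    · linear_combination -h0
  -- Shifting the entry whose coefficient is non-zero moves any matrix onto the zero set of the
  -- affine form of `z`. There `key` applies, which makes the form of `w` the multiple of that of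
  -- `z` by the ratio of the two coefficients.
  rcases hlin with h1 | h1 | h1 | h1
  · refine fin (w 1 / z 1) fun A B C D => ?_
    have := key A B (C - (z 1 * C - z 2 * A + z 3 * D - z 4 * B + z 5) / z 1) D
      (by field_simp; ring)
    field_simp at this ⊢
    linear_combination this
  · refine fin (w 2 / z 2) fun A B C D => ?_
    have := key (A + (z 1 * C - z 2 * A + z 3 * D - z 4 * B + z 5) / z 2) B C D
      (by field_simp; ring)
    field_simp at this ⊢
    linear_combination this
  · refine fin (w 3 / z 3) fun A B C D => ?_
    have := key A B C (D - (z 1 * C - z 2 * A + z 3 * D - z 4 * B + z 5) / z 3)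
      (by field_simp; ring)
    field_simp at this ⊢
    linear_combination this
  · refine fin (w 4 / z 4) fun A B C D => ?_
    have := key A (B + (z 1 * C - z 2 * A + z 3 * D - z 4 * B + z 5) / z 4) C D
      (by field_simp; ring)
    field_simp at this ⊢
    linear_combination this

theorem liesIn_mk_iff (Ω : Set ℍ[ℝ]) (f : ℍ[ℝ] → ℍ[ℝ]) {w : Fin 6 → ℂ} (hw : w ≠ 0) :
    LiesIn Ω f (Projectivization.mk ℂ w hw) ↔ ∀ v ∈ upperSlice Ω,
      w 0 * (splitG f v * hat (splitG f) v + splitH f v * hat (splitH f) v) + w 1 * splitH f v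
        - w 2 * splitG f v + w 3 * hat (splitG f) v + w 4 * hat (splitH f) v + w 5 = 0 := by
  rw [LiesIn, Set.image_subset_iff]
  refine forall₂_congr fun v _ => ?_
  rw [Set.mem_preimage, twistor, graphPlane_mem_hyperplaneSection]
  simp only [graphMatrix, Matrix.det_fin_two_of, Matrix.of_apply, Matrix.cons_val', Matrix.cons_val_zero,
    Matrix.cons_val_one, Matrix.cons_val_fin_one]
  ring_nf

/-! ### The splitting of a slice-regular polynomial -/

/-- By openness, a short vertical segment above a real point of `Ω` stays in `Ω`. -/
theorem upperSlice_infinite {Ω : Set ℍ[ℝ]} (hΩ : IsSymmetricSliceDomain Ω) :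
    (upperSlice Ω).Infinite := by
  obtain ⟨x, hx⟩ := hΩ.meets_real
  have hcont : Continuous fun t : ℝ => (((x : ℂ) + t * Complex.I : ℂ) : ℍ[ℝ]) := by
    have h1 : Continuous fun v : ℂ => (v : ℍ[ℝ]) :=
      LinearMap.continuous_of_finiteDimensional Quaternion.ofComplex.toLinearMap
    exact h1.comp (by fun_prop)
  have hopen := hΩ.isOpen.preimage hcont
  have h0 : (0 : ℝ) ∈ (fun t : ℝ => (((x : ℂ) + t * Complex.I : ℂ) : ℍ[ℝ])) ⁻¹' Ω := by
    simpa using hx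
  obtain ⟨ε, hε, hball⟩ := Metric.isOpen_iff.1 hopen 0 h0
  have hinj : Function.Injective fun t : ℝ => ((x : ℂ) + t * Complex.I : ℂ) := by
    intro s t h
    simpa using congrArg Complex.im h
  refine ((Set.Ioo_infinite hε).image hinj.injOn).mono ?_
  rintro _ ⟨t, ⟨ht0, ht⟩, rfl⟩
  refine ⟨by simpa using ht0, ?_⟩
  apply hball
  simpa [abs_of_pos ht0] using ht

theorem fstC_sum {ι : Type*} (s : Finset ι) (q : ι → ℍ[ℝ]) :
    fstC (∑ m ∈ s, q m) = ∑ m ∈ s, fstC (q m) := by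
  classical
  induction s using Finset.induction_on with
  | empty => simp [fstC]; rfl
  | insert m s hm ih =>
    rw [Finset.sum_insert hm, Finset.sum_insert hm, ← ih]
    apply Complex.ext <;> simp [fstC]

theorem sndC_sum {ι : Type*} (s : Finset ι) (q : ι → ℍ[ℝ]) :
    sndC (∑ m ∈ s, q m) = ∑ m ∈ s, sndC (q m) := by
  classical
  induction s using Finset.induction_on with
  | empty => simp [sndC]; rfl
  | insert m s hm ih =>
    rw [Finset.sum_insert hm, Finset.sum_insert hm, ← ih]
    apply Complex.ext <;> simp [sndC]

theorem fstC_coe_mul (v : ℂ) (q : ℍ[ℝ]) : fstC (v * q) = v * fstC q := by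
  apply Complex.ext <;> simp [fstC]

theorem sndC_coe_mul (v : ℂ) (q : ℍ[ℝ]) : sndC (v * q) = v * sndC q := by
  apply Complex.ext <;> simp [sndC]

theorem coeComplex_pow (v : ℂ) (m : ℕ) : ((v ^ m : ℂ) : ℍ[ℝ]) = (v : ℍ[ℝ]) ^ m :=
  map_pow Quaternion.ofComplex v m

open Polynomial in
/-- The polynomial `∑_{m=0}^n b_m X^m`. -/
noncomputable def polyOf (n : ℕ) (b : ℕ → ℂ) : ℂ[X] := ∑ m ∈ Finset.range (n + 1), C (b m) * X ^ m

theorem eval_polyOf (n : ℕ) (b : ℕ → ℂ) (v : ℂ) :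
    (polyOf n b).eval v = ∑ m ∈ Finset.range (n + 1), b m * v ^ m := by
  simp [polyOf, Polynomial.eval_finsetSum]

theorem coeff_polyOf (n : ℕ) (b : ℕ → ℂ) (k : ℕ) :
    (polyOf n b).coeff k = if k ≤ n then b k else 0 := by
  simp [polyOf, Polynomial.coeff_C_mul, Polynomial.coeff_X_pow]

theorem splitG_slicePoly (n : ℕ) (a : ℕ → ℍ[ℝ]) (v : ℂ) :
    splitG (slicePoly n a) v = (polyOf n fun m => fstC (a m)).eval v := by
  rw [splitG, slicePoly, fstC_sum, eval_polyOf]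
  refine Finset.sum_congr rfl fun m _ => ?_
  rw [← coeComplex_pow, fstC_coe_mul, mul_comm]

theorem splitH_slicePoly (n : ℕ) (a : ℕ → ℍ[ℝ]) (v : ℂ) :
    splitH (slicePoly n a) v = (polyOf n fun m => sndC (a m)).eval v := by
  rw [splitH, slicePoly, sndC_sum, eval_polyOf]
  refine Finset.sum_congr rfl fun m _ => ?_
  rw [← coeComplex_pow, sndC_coe_mul, mul_comm]

theorem hat_eval_polyOf (n : ℕ) (b : ℕ → ℂ) (v : ℂ) :
    hat (fun v => (polyOf n b).eval v) v = (polyOf n fun m => star (b m)).eval v := by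
  simp [hat, eval_polyOf]

theorem hat_splitG_slicePoly (n : ℕ) (a : ℕ → ℍ[ℝ]) (v : ℂ) :
    hat (splitG (slicePoly n a)) v = (polyOf n fun m => star (fstC (a m))).eval v := by
  rw [← hat_eval_polyOf, funext (splitG_slicePoly n a)]

theorem hat_splitH_slicePoly (n : ℕ) (a : ℕ → ℍ[ℝ]) (v : ℂ) :
    hat (splitH (slicePoly n a)) v = (polyOf n fun m => star (sndC (a m))).eval v := by
  rw [← hat_eval_polyOf, funext (splitH_slicePoly n a)]

/-- The coefficient `a n` itself may vanish, so the true degree `N` has to be found; non-constancy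
gives `1 ≤ N`. -/
theorem exists_leading_index {n : ℕ} {a : ℕ → ℍ[ℝ]}
    (hconst : ¬ ∃ c, ∀ q, slicePoly n a q = c) :
    ∃ N, 1 ≤ N ∧ N ≤ n ∧ a N ≠ 0 ∧ ∀ k, N < k → k ≤ n → a k = 0 := by
  classical
  have hex : ∃ m, 1 ≤ m ∧ m ≤ n ∧ a m ≠ 0 := by
    by_contra! hne
    refine hconst ⟨a 0, fun q => ?_⟩
    rw [slicePoly, Finset.sum_range_succ', Finset.sum_eq_zero]
    · simp
    · intro m hm
      rw [hne (m + 1) (by omega) (by have := Finset.mem_range.1 hm; omega), mul_zero]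
  obtain ⟨m, hm1, hmn, ham⟩ := hex
  refine ⟨Nat.findGreatest (fun k => a k ≠ 0) n, ?_, Nat.findGreatest_le n,
    Nat.findGreatest_spec (P := fun k => a k ≠ 0) hmn ham, fun k hk hkn => ?_⟩
  · exact hm1.trans (Nat.le_findGreatest hmn ham)
  · exact not_not.1 (Nat.findGreatest_is_greatest hk hkn)

theorem natDegree_polyOf_le {n N : ℕ} {b : ℕ → ℂ} (h : ∀ k, N < k → k ≤ n → b k = 0) :
    (polyOf n b).natDegree ≤ N := by
  rw [Polynomial.natDegree_le_iff_coeff_eq_zero]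
  intro k hk
  rw [coeff_polyOf]
  split_ifs with hkn
  · exact h k hk hkn
  · rfl

open Polynomial in
/-- The curve of a non-constant polynomial lies in the hyperplane of `w` exactly if `w` annihilates
the coefficients. -/
theorem liesIn_slicePoly_iff {Ω : Set ℍ[ℝ]} (hΩ : IsSymmetricSliceDomain Ω) {n : ℕ}
    {a : ℕ → ℍ[ℝ]} (hconst : ¬ ∃ c, ∀ q, slicePoly n a q = c) {w : Fin 6 → ℂ} (hw : w ≠ 0) :
    LiesIn Ω (slicePoly n a) (Projectivization.mk ℂ w hw) ↔ w 0 = 0 ∧ ∀ m ≤ n,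
      w 1 * sndC (a m) - w 2 * fstC (a m) + w 3 * star (fstC (a m)) + w 4 * star (sndC (a m))
        + (if m = 0 then w 5 else 0) = 0 := by
  rw [liesIn_mk_iff]
  simp only [hat_splitG_slicePoly, hat_splitH_slicePoly]
  simp only [splitG_slicePoly, splitH_slicePoly]
  set G := polyOf n fun m => fstC (a m) with hG
  set H := polyOf n fun m => sndC (a m) with hH
  set G' := polyOf n fun m => star (fstC (a m)) with hG'
  set H' := polyOf n fun m => star (sndC (a m)) with hH'
  set P : ℂ[X] := C (w 0) * (G * G' + H * H') + (C (w 1) * H - C (w 2) * G + C (w 3) * G'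
    + C (w 4) * H' + C (w 5)) with hP
  have hPeval : ∀ v, P.eval v = w 0 * (G.eval v * G'.eval v + H.eval v * H'.eval v)
      + w 1 * H.eval v - w 2 * G.eval v + w 3 * G'.eval v + w 4 * H'.eval v + w 5 := by
    intro v
    simp [hP]
    ring
  simp only [← hPeval]
  have hP0 : (∀ v ∈ upperSlice Ω, P.eval v = 0) ↔ P = 0 := by
    refine ⟨fun h => Polynomial.eq_zero_of_infinite_isRoot P
      ((upperSlice_infinite hΩ).mono fun v hv => h v hv), fun h v _ => by simp [h]⟩
  have hlin : ∀ k, (C (w 1) * H - C (w 2) * G + C (w 3) * G'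
      + C (w 4) * H' + C (w 5)).coeff k = if k ≤ n then
      w 1 * sndC (a k) - w 2 * fstC (a k) + w 3 * star (fstC (a k)) + w 4 * star (sndC (a k))
        + (if k = 0 then w 5 else 0) else 0 := by
    intro k
    simp only [coeff_add, coeff_sub, coeff_C_mul, hG, hH, hG', hH', coeff_polyOf, coeff_C]
    split_ifs <;> simp_all
  rw [hP0]
  constructor
  · intro hz
    have hw0 : w 0 = 0 := by
      obtain ⟨N, hN1, hNn, haN, hN⟩ := exists_leading_index hconst
      have e : ∀ k, N < k → k ≤ n → fstC (a k) = 0 ∧ sndC (a k) = 0 := by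
        intro k hk hkn
        rw [hN k hk hkn]
        exact ⟨rfl, rfl⟩
      have dG : G.natDegree ≤ N := natDegree_polyOf_le fun k h1 h2 => (e k h1 h2).1
      have dH : H.natDegree ≤ N := natDegree_polyOf_le fun k h1 h2 => (e k h1 h2).2
      have dG' : G'.natDegree ≤ N := natDegree_polyOf_le fun k h1 h2 => by
        rw [(e k h1 h2).1, star_zero]
      have dH' : H'.natDegree ≤ N := natDegree_polyOf_le fun k h1 h2 => by
        rw [(e k h1 h2).2, star_zero]
      have hc : P.coeff (N + N) = 0 := by rw [hz, coeff_zero]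
      -- Because `N ≥ 1`, the degree `2N` exceeds both `N` and `0`, so neither the linear part nor
      -- the constant `w 5` contributes.
      have hl : (C (w 1) * H - C (w 2) * G + C (w 3) * G'
          + C (w 4) * H' + C (w 5)).coeff (N + N) = 0 := by
        rw [hlin]
        split_ifs with h1 h2
        · omega
        · have := e (N + N) (by omega) h1
          simp [this.1, this.2]
        · rfl
      -- The remaining coefficient is `w 0` times `|fstC (a N)|² + |sndC (a N)|² = |a N|²`, which is
      -- non-zero.
      rw [hP, coeff_add, hl, add_zero, coeff_C_mul, coeff_add, coeff_mul_add_eq_of_natDegree_le dG dG',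
        coeff_mul_add_eq_of_natDegree_le dH dH'] at hc
      simp only [hG, hG', hH, hH', coeff_polyOf, if_pos hNn] at hc
      refine (mul_eq_zero.1 hc).resolve_right fun hs => haN ?_
      have hre := congrArg Complex.re hs
      simp [fstC, sndC] at hre
      ext <;> simp <;> nlinarith [sq_nonneg (a N).re, sq_nonneg (a N).imI, sq_nonneg (a N).imJ,
        sq_nonneg (a N).imK]
    refine ⟨hw0, fun m hm => ?_⟩
    have := congrArg (fun Q : ℂ[X] => Q.coeff m) hz
    simpa only [hP, hw0, C_0, zero_mul, zero_add, hlin, if_pos hm, coeff_zero] using this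
  · rintro ⟨hw0, hm⟩
    ext k
    rw [hP, hw0, C_0, zero_mul, zero_add, hlin, coeff_zero]
    split_ifs with h1 h2
    · subst h2; simpa using hm 0 h1
    · simpa [h2] using hm k h1
    · rfl

/-! ### The space of annihilating maps -/

/-- The map `b + c j ↦ z₂ c - z₃ b + z₄ b̄ + z₅ c̄`. -/
noncomputable def ofCoef (z₂ z₃ z₄ z₅ : ℂ) : ℍ[ℝ] →ₗ[ℝ] ℂ where
  toFun q := z₂ * sndC q - z₃ * fstC q + z₄ * star (fstC q) + z₅ * star (sndC q)
  map_add' x y := by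
    have h1 : fstC (x + y) = fstC x + fstC y := by apply Complex.ext <;> simp [fstC]
    have h2 : sndC (x + y) = sndC x + sndC y := by apply Complex.ext <;> simp [sndC]
    rw [h1, h2, star_add, star_add]
    ring
  map_smul' c x := by
    have h1 : fstC (c • x) = c * fstC x := by apply Complex.ext <;> simp [fstC]
    have h2 : sndC (c • x) = c * sndC x := by apply Complex.ext <;> simp [sndC]
    have h3 : star (c : ℂ) = c := Complex.conj_ofReal c
    rw [h1, h2, star_mul', star_mul', h3, RingHom.id_apply, Complex.real_smul]
    ring

theorem ofCoef_apply (z₂ z₃ z₄ z₅ : ℂ) (q : ℍ[ℝ]) : ofCoef z₂ z₃ z₄ z₅ q =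
    z₂ * sndC q - z₃ * fstC q + z₄ * star (fstC q) + z₅ * star (sndC q) := rfl

theorem ofCoef_units (z₂ z₃ z₄ z₅ : ℂ) : ofCoef z₂ z₃ z₄ z₅ 1 = -z₃ + z₄ ∧
    ofCoef z₂ z₃ z₄ z₅ qi = -Complex.I * z₃ - Complex.I * z₄ ∧
    ofCoef z₂ z₃ z₄ z₅ qj = z₂ + z₅ ∧
    ofCoef z₂ z₃ z₄ z₅ qk = Complex.I * z₂ - Complex.I * z₅ := by
  have h1 : fstC 1 = 1 := by apply Complex.ext <;> simp [fstC]
  have h2 : sndC 1 = 0 := by apply Complex.ext <;> simp [sndC]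
  have h3 : fstC qi = Complex.I := by apply Complex.ext <;> simp [fstC, qi_parts]
  have h4 : sndC qi = 0 := by apply Complex.ext <;> simp [sndC, qi_parts]
  have h5 : fstC qj = 0 := by apply Complex.ext <;> simp [fstC, qj_parts]
  have h6 : sndC qj = 1 := by apply Complex.ext <;> simp [sndC, qj_parts]
  have h7 : fstC qk = 0 := by apply Complex.ext <;> simp [fstC, qk_parts]
  have h8 : sndC qk = Complex.I := by apply Complex.ext <;> simp [sndC, qk_parts]
  have h9 : star Complex.I = -Complex.I := Complex.conj_I
  simp only [ofCoef_apply, h1, h2, h3, h4, h5, h6, h7, h8, h9, star_zero, star_one]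
  refine ⟨?_, ?_, ?_, ?_⟩ <;> ring

theorem coef_ofCoef (z₂ z₃ z₄ z₅ : ℂ) :
    coef2 (ofCoef z₂ z₃ z₄ z₅) = z₂ ∧ coef3 (ofCoef z₂ z₃ z₄ z₅) = z₃ ∧
    coef4 (ofCoef z₂ z₃ z₄ z₅) = z₄ ∧ coef5 (ofCoef z₂ z₃ z₄ z₅) = z₅ := by
  obtain ⟨h1, h2, h3, h4⟩ := ofCoef_units z₂ z₃ z₄ z₅
  simp only [coef2, coef3, coef4, coef5, h1, h2, h3, h4]
  have := Complex.I_sq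
  refine ⟨?_, ?_, ?_, ?_⟩ <;> grind

/-- Maps that annihilate `S` are maps on the quotient by `S`. -/
noncomputable def annihilatorEquiv (S : Submodule ℝ ℍ[ℝ]) :
    ((ℍ[ℝ] ⧸ S) →ₗ[ℝ] ℂ) ≃ₗ[ℂ] annihilator S where
  toFun φ := ⟨φ.comp S.mkQ, fun s hs => by
    rw [LinearMap.comp_apply, Submodule.mkQ_apply, (Submodule.Quotient.mk_eq_zero S).2 hs, map_zero]⟩
  map_add' _ _ := rfl
  map_smul' _ _ := rfl
  invFun Λ := S.liftQ Λ.1 fun s hs => Λ.2 s hs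
  left_inv φ := by
    ext x
    rfl
  right_inv Λ := by
    ext x
    rfl

/-- The complex dimension of `Hom_ℝ(W, ℂ)` is the real dimension of `W`, applied to `W = ℍ/S`. -/
theorem finrank_annihilator (S : Submodule ℝ ℍ[ℝ]) :
    Module.finrank ℂ (annihilator S) + Module.finrank ℝ S = 4 := by
  rw [← (annihilatorEquiv S).finrank_eq, Module.finrank_linearMap ℝ ℂ, Module.finrank_self, mul_one,
    Submodule.finrank_quotient_add_finrank, Quaternion.finrank_eq_four]

theorem projIso_of_finrank_eq {E F : Type*} [AddCommGroup E] [Module ℂ E] [AddCommGroup F]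
    [Module ℂ F] [FiniteDimensional ℂ E] [FiniteDimensional ℂ F]
    (h : Module.finrank ℂ E = Module.finrank ℂ F) : ProjIso E F := by
  let φ := LinearEquiv.ofFinrankEq E F h
  refine ⟨Equiv.ofBijective (Projectivization.map φ.toLinearMap φ.injective)
    ⟨Projectivization.map_injective _ _, fun p => ?_⟩, φ, fun p => rfl⟩
  induction p with | h v hv =>
  refine ⟨Projectivization.mk ℂ (φ.symm v) (by simpa using hv), ?_⟩
  rw [Projectivization.map_mk]
  congr 1
  simp

theorem mem_annihilator_coeffSpan {n : ℕ} {a : ℕ → ℍ[ℝ]} {Λ : ℍ[ℝ] →ₗ[ℝ] ℂ} :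
    Λ ∈ annihilator (coeffSpan n a) ↔ ∀ m, 1 ≤ m → m ≤ n → Λ (a m) = 0 := by
  have : Λ ∈ annihilator (coeffSpan n a) ↔ coeffSpan n a ≤ LinearMap.ker Λ := Iff.rfl
  rw [this, coeffSpan, Submodule.span_le, Set.image_subset_iff]
  exact ⟨fun h m h1 h2 => h ⟨h1, h2⟩, fun h m hm => h m hm.1 hm.2⟩

theorem covec_ne_zero {a₀ : ℍ[ℝ]} {Λ : ℍ[ℝ] →ₗ[ℝ] ℂ} (hΛ : Λ ≠ 0) : covec a₀ Λ ≠ 0 :=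
  fun h => hΛ (covec_injective a₀ (h.trans (map_zero _).symm))

/-- A hyperplane section contains the curve of a non-constant polynomial exactly if its covector
comes from an annihilating map. -/
theorem liesIn_iff_exists_covec {Ω : Set ℍ[ℝ]} (hΩ : IsSymmetricSliceDomain Ω) {n : ℕ}
    {a : ℕ → ℍ[ℝ]} (hconst : ¬ ∃ c, ∀ q, slicePoly n a q = c) {w : Fin 6 → ℂ} (hw : w ≠ 0) :
    LiesIn Ω (slicePoly n a) (Projectivization.mk ℂ w hw) ↔
      ∃ Λ ∈ annihilator (coeffSpan n a), covec (a 0) Λ = w := by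
  rw [liesIn_slicePoly_iff hΩ hconst]
  constructor
  · rintro ⟨hw0, hm⟩
    obtain ⟨h2, h3, h4, h5⟩ := coef_ofCoef (w 1) (w 2) (w 3) (w 4)
    refine ⟨ofCoef (w 1) (w 2) (w 3) (w 4), ?_, ?_⟩
    · rw [mem_annihilator_coeffSpan]
      intro m h1 hmn
      simpa [show m ≠ 0 by omega, ofCoef_apply] using hm m hmn
    · have h0 := hm 0 (Nat.zero_le n)
      rw [if_pos rfl, ← ofCoef_apply] at h0
      funext k
      fin_cases k
      · exact hw0.symm
      · exact h2
      · exact h3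
      · exact h4
      · exact h5
      · change -(ofCoef (w 1) (w 2) (w 3) (w 4)) (a 0) = w 5
        linear_combination -h0
  · rintro ⟨Λ, hΛ, rfl⟩
    rw [mem_annihilator_coeffSpan] at hΛ
    refine ⟨rfl, fun m hm => ?_⟩
    have h := apply_eq_coef Λ (a m)
    change coef2 Λ * sndC (a m) - coef3 Λ * fstC (a m) + coef4 Λ * star (fstC (a m))
      + coef5 Λ * star (sndC (a m)) + (if m = 0 then -Λ (a 0) else 0) = 0
    rw [← h]
    split_ifs with h0
    · rw [h0, add_neg_cancel]
    · rw [hΛ m (by omega) hm, add_zero]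

/-! ### Parametrization of covectors and of hyperplane sections by `ℙ(𝒜_f)` -/

theorem covecMap_mk (a₀ : ℍ[ℝ]) (𝒜 : Submodule ℂ (ℍ[ℝ] →ₗ[ℝ] ℂ)) (Λ : 𝒜) (hΛ : Λ ≠ 0) :
    covecMap a₀ 𝒜 (Projectivization.mk ℂ Λ hΛ) =
      Projectivization.mk ℂ (covec a₀ Λ.1) (covec_ne_zero (Subtype.coe_ne_coe.2 hΛ)) :=
  rfl

theorem covecMap_injective (a₀ : ℍ[ℝ]) (𝒜 : Submodule ℂ (ℍ[ℝ] →ₗ[ℝ] ℂ)) :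
    Function.Injective (covecMap a₀ 𝒜) :=
  Projectivization.map_injective _ _

theorem bijOn_covecMap {Ω : Set ℍ[ℝ]} (hΩ : IsSymmetricSliceDomain Ω) {n : ℕ}
    {a : ℕ → ℍ[ℝ]} (hconst : ¬ ∃ c, ∀ q, slicePoly n a q = c) :
    Set.BijOn (covecMap (a 0) (annihilator (coeffSpan n a))) Set.univ
      {z | LiesIn Ω (slicePoly n a) z} := by
  refine ⟨fun P _ => ?_, (covecMap_injective _ _).injOn, fun z hz => ?_⟩
  · induction P with | h Λ hΛ =>
    rw [covecMap_mk]
    exact (liesIn_iff_exists_covec hΩ hconst _).2 ⟨Λ.1, Λ.2, rfl⟩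
  · induction z with | h w hw =>
    obtain ⟨Λ, hΛ, rfl⟩ := (liesIn_iff_exists_covec hΩ hconst hw).1 hz
    refine ⟨Projectivization.mk ℂ ⟨Λ, hΛ⟩ ?_, Set.mem_univ _, rfl⟩
    intro h
    apply hw
    rw [show Λ = 0 from congrArg Subtype.val h, map_zero]

/-- The coefficients `z₂, …, z₅` determine `Λ`, so they do not all vanish when `Λ ≠ 0`; this is the
non-constancy that `eq_of_hyperplaneSection_eq` needs. -/
theorem hyperplaneSection_covecMap_injective (a₀ : ℍ[ℝ]) (𝒜 : Submodule ℂ (ℍ[ℝ] →ₗ[ℝ] ℂ)) :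
    Function.Injective fun P => hyperplaneSection (covecMap a₀ 𝒜 P) := by
  intro P Q h
  apply covecMap_injective a₀ 𝒜
  induction P with | h Λ hΛ =>
  induction Q with | h Λ' hΛ' =>
  simp only [covecMap_mk] at h ⊢
  refine eq_of_hyperplaneSection_eq _ _ rfl rfl ?_ h
  by_contra! hc
  obtain ⟨h2, h3, h4, h5⟩ := hc
  refine hΛ (Subtype.ext (LinearMap.ext fun q => ?_))
  rw [apply_eq_coef, show coef2 Λ.1 = 0 from h2, show coef3 Λ.1 = 0 from h3,
    show coef4 Λ.1 = 0 from h4, show coef5 Λ.1 = 0 from h5]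
  simp

theorem bijOn_hyperplaneSection_covecMap {Ω : Set ℍ[ℝ]} (hΩ : IsSymmetricSliceDomain Ω) {n : ℕ}
    {a : ℕ → ℍ[ℝ]} (hconst : ¬ ∃ c, ∀ q, slicePoly n a q = c) :
    Set.BijOn
      (fun P => hyperplaneSection (covecMap (a 0) (annihilator (coeffSpan n a)) P)) Set.univ
      {X | X ∈ Set.range hyperplaneSection ∧
        twistor (slicePoly n a) '' upperSlice Ω ⊆ X} := by
  refine ⟨fun P hP => ⟨⟨_, rfl⟩, (bijOn_covecMap hΩ hconst).mapsTo hP⟩,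
    (hyperplaneSection_covecMap_injective _ _).injOn, ?_⟩
  rintro _ ⟨⟨z, rfl⟩, hz⟩
  obtain ⟨P, hP, rfl⟩ := (bijOn_covecMap hΩ hconst).surjOn (show LiesIn Ω (slicePoly n a) z from hz)
  exact ⟨P, hP, rfl⟩

theorem finrank_coeffSpan_le {Ω : Set ℍ[ℝ]} (hΩ : IsSymmetricSliceDomain Ω) {n : ℕ}
    {a : ℕ → ℍ[ℝ]} (hconst : ¬ ∃ c, ∀ q, slicePoly n a q = c)
    (hplanar : IsPlanar Ω (slicePoly n a)) : Module.finrank ℝ (coeffSpan n a) ≤ 3 := by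
  obtain ⟨z, hz⟩ := hplanar
  obtain ⟨P, -, -⟩ := (bijOn_covecMap hΩ hconst).surjOn hz
  have : FiniteDimensional ℂ (annihilator (coeffSpan n a)) :=
    Module.Finite.equiv (annihilatorEquiv _)
  have : Nontrivial (annihilator (coeffSpan n a)) := ⟨⟨P.rep, 0, P.rep_nonzero⟩⟩
  have h1 := Module.finrank_pos (R := ℂ) (M := annihilator (coeffSpan n a))
  have h2 := finrank_annihilator (coeffSpan n a)
  omega

/-- The bound `h` keeps the natural-number subtraction from truncating, so `3 - r + 1` is the
dimension `4 - r`. -/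
theorem projIso_annihilator {n : ℕ} {a : ℕ → ℍ[ℝ]} (h : Module.finrank ℝ (coeffSpan n a) ≤ 3) :
    ProjIso (annihilator (coeffSpan n a))
      (Fin (3 - Module.finrank ℝ (coeffSpan n a) + 1) → ℂ) := by
  have : FiniteDimensional ℂ (annihilator (coeffSpan n a)) :=
    Module.Finite.equiv (annihilatorEquiv _)
  apply projIso_of_finrank_eq
  rw [Module.finrank_fin_fun]
  have h2 := finrank_annihilator (coeffSpan n a)
  omega

/-! ### Elements of `GL(2, ℍ)` and their orbits -/

/-- The complex form of the quaternionic matrix with rows `(α, β)` and `(γ, δ)`. -/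
def quatMatrix (α β γ δ : ℍ[ℝ]) : Matrix (Fin 4) (Fin 4) ℂ :=
  !![fstC α, -star (sndC α), fstC β, -star (sndC β);
     sndC α, star (fstC α), sndC β, star (fstC β);
     fstC γ, -star (sndC γ), fstC δ, -star (sndC δ);
     sndC γ, star (fstC γ), sndC δ, star (fstC δ)]

theorem fstC_add (p q : ℍ[ℝ]) : fstC (p + q) = fstC p + fstC q := by
  apply Complex.ext <;> simp [fstC]

theorem sndC_add (p q : ℍ[ℝ]) : sndC (p + q) = sndC p + sndC q := by
  apply Complex.ext <;> simp [sndC]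

theorem fstC_mul (p q : ℍ[ℝ]) : fstC (p * q) = fstC p * fstC q - sndC p * star (sndC q) := by
  apply Complex.ext <;> simp [fstC, sndC] <;> ring

theorem sndC_mul (p q : ℍ[ℝ]) : sndC (p * q) = fstC p * sndC q + sndC p * star (fstC q) := by
  apply Complex.ext <;> simp [fstC, sndC] <;> ring

theorem fstC_one : fstC 1 = 1 := by apply Complex.ext <;> simp [fstC]

theorem sndC_one : sndC 1 = 0 := by apply Complex.ext <;> simp [sndC]

theorem fstC_zero : fstC 0 = 0 := rfl

theorem sndC_zero : sndC 0 = 0 := rfl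

theorem quatMatrix_one : quatMatrix 1 0 0 1 = 1 := by
  simp only [quatMatrix, fstC_one, sndC_one, fstC_zero, sndC_zero, star_zero, star_one, neg_zero]
  ext k l
  fin_cases k <;> fin_cases l <;> rfl

/-- The factors are reversed because the block `M(q)` of a quaternion satisfies `M(p) M(q) = M(qp)`.
-/
theorem quatMatrix_mul (α β γ δ α' β' γ' δ' : ℍ[ℝ]) :
    quatMatrix α β γ δ * quatMatrix α' β' γ' δ' =
      quatMatrix (α' * α + γ' * β) (β' * α + δ' * β) (α' * γ + γ' * δ) (β' * γ + δ' * δ) := by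
  ext k l
  fin_cases k <;> fin_cases l <;>
    simp [quatMatrix, Matrix.mul_apply, Fin.sum_univ_four, fstC_add, sndC_add, fstC_mul, sndC_mul] <;>
    ring

theorem exists_mem_GL2H {α β γ δ α' β' γ' δ' : ℍ[ℝ]}
    (h : quatMatrix α β γ δ * quatMatrix α' β' γ' δ' = 1) :
    ∃ T ∈ GL2H, T.1 = quatMatrix α β γ δ := by
  refine ⟨⟨quatMatrix α β γ δ, quatMatrix α' β' γ' δ', h, mul_eq_one_comm.1 h⟩, ?_, rfl⟩
  rw [mem_GL2H_iff]
  simp [Fin.forall_fin_two, blockIdx, quatMatrix]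

/-! ### The orbit relation on bivectors -/

/-- Up to scaling, `q` is the image of the bivector `p` under an element of `GL(2, ℍ)`. -/
def SameOrbit (p q : Fin 6 → ℂ) : Prop := ∃ T ∈ GL2H, ∃ c : ℂ, c ≠ 0 ∧ wedgeMap T.1 p = c • q

theorem wedgeMap_mul (S T : Matrix (Fin 4) (Fin 4) ℂ) (p : Fin 6 → ℂ) :
    wedgeMap (S * T) p = wedgeMap S (wedgeMap T p) :=
  LinearMap.congr_fun (wedgeHom.map_mul S T) p

theorem wedgeMap_one (p : Fin 6 → ℂ) : wedgeMap 1 p = p :=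
  LinearMap.congr_fun wedgeHom.map_one p

theorem SameOrbit.trans {p q s : Fin 6 → ℂ} (h₁ : SameOrbit p q) (h₂ : SameOrbit q s) :
    SameOrbit p s := by
  obtain ⟨T, hT, c, hc, e⟩ := h₁
  obtain ⟨T', hT', c', hc', e'⟩ := h₂
  refine ⟨T' * T, mul_mem hT' hT, c * c', mul_ne_zero hc hc', ?_⟩
  rw [Units.val_mul, wedgeMap_mul, e, map_smul, e', smul_smul]

theorem SameOrbit.symm {p q : Fin 6 → ℂ} (h : SameOrbit p q) : SameOrbit q p := by
  obtain ⟨T, hT, c, hc, e⟩ := h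
  refine ⟨T⁻¹, inv_mem hT, c⁻¹, inv_ne_zero hc, ?_⟩
  rw [← inv_smul_smul₀ hc q, ← e, map_smul, ← wedgeMap_mul, ← Units.val_mul, inv_mul_cancel,
    Units.val_one, wedgeMap_one]

theorem sameOrbit_smul {c : ℂ} (hc : c ≠ 0) (p : Fin 6 → ℂ) : SameOrbit (c • p) p :=
  ⟨1, one_mem _, c, hc, by rw [Units.val_one, wedgeMap_one]⟩

theorem SameOrbit.mem_orbit {p q : Fin 6 → ℂ} (h : SameOrbit p q) (hp : p ≠ 0) (hq : q ≠ 0) :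
    Projectivization.mk ℂ q hq ∈ orbit (Projectivization.mk ℂ p hp) := by
  obtain ⟨T, hT, c, hc, e⟩ := h
  refine ⟨⟨Units.map wedgeHom T, Subgroup.mem_map_of_mem _ hT⟩, ?_⟩
  exact (Projectivization.mk_eq_mk_iff' ℂ (wedgeMap T.1 p) q _ hq).2 ⟨c, e.symm⟩

theorem kappaLin_kappaLin (z : Fin 6 → ℂ) : kappaLin (kappaLin z) = z := by
  funext k
  fin_cases k <;> simp [kappaLin]

/-- If the pole of `z` lies in the orbit of `p`, then `z` lies in the polar of that orbit. -/
theorem mk_mem_kappa_image_orbit {p z : Fin 6 → ℂ} (hp : p ≠ 0) (hz : z ≠ 0)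
    (h : SameOrbit p (kappaLin z)) :
    Projectivization.mk ℂ z hz ∈ kappa '' orbit (Projectivization.mk ℂ p hp) := by
  have hk : kappaLin z ≠ 0 := fun h0 => hz (kappaLin_injective (h0.trans (map_zero _).symm))
  refine ⟨_, h.mem_orbit hp hk, ?_⟩
  rw [kappa, Projectivization.map_mk]
  congr 1
  exact kappaLin_kappaLin z

/-- Translation of `f` by a constant moves the curve within its orbit. -/
theorem sameOrbit_covec (a₀ : ℍ[ℝ]) (Λ : ℍ[ℝ] →ₗ[ℝ] ℂ) :
    SameOrbit (kappaLin (covec 0 Λ)) (kappaLin (covec a₀ Λ)) := by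
  -- This matrix sends the graph of `Φ` to the graph of `Φ + M(a₀)`, where `M(a₀)` is the block of
  -- `a₀`.
  obtain ⟨T, hT, e⟩ := exists_mem_GL2H
    (show quatMatrix 1 0 a₀ 1 * quatMatrix 1 0 (-a₀) 1 = 1 by
      rw [quatMatrix_mul, ← quatMatrix_one]; simp)
  refine ⟨T, hT, 1, one_ne_zero, ?_⟩
  rw [e, one_smul, wedgeMap_apply]
  funext k
  have h0 := apply_eq_coef Λ a₀
  fin_cases k <;>
    simp [quatMatrix, fstC_one, sndC_one, fstC_zero, sndC_zero, kappaLin, covec, wedge,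
      Matrix.col]
  rw [h0]
  simp
  ring

theorem comp_mulLeft_eq_ofCoef (α : ℍ[ℝ]) (Λ : ℍ[ℝ] →ₗ[ℝ] ℂ) :
    Λ.comp (LinearMap.mulLeft ℝ α) = ofCoef
      (coef2 Λ * fstC α - coef4 Λ * star (sndC α)) (coef3 Λ * fstC α - coef5 Λ * star (sndC α))
      (coef2 Λ * sndC α + coef4 Λ * star (fstC α)) (coef3 Λ * sndC α + coef5 Λ * star (fstC α)) := by
  refine LinearMap.ext fun q => ?_
  rw [LinearMap.comp_apply, LinearMap.mulLeft_apply, apply_eq_coef, ofCoef_apply, fstC_mul, sndC_mul]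
  simp only [star_sub, star_add, star_mul', star_star]
  ring

theorem kappaLin_covec_zero_ofCoef (z₂ z₃ z₄ z₅ : ℂ) :
    kappaLin (covec 0 (ofCoef z₂ z₃ z₄ z₅)) = ![0, -z₅, z₄, z₃, -z₂, 0] := by
  obtain ⟨h2, h3, h4, h5⟩ := coef_ofCoef z₂ z₃ z₄ z₅
  funext k
  fin_cases k <;> simp [kappaLin, covec, h2, h3, h4, h5]

/-- The matrix `diag(α, 1)` sends the graph of `M(q)` to that of `M(q) M(α)⁻¹ = M(α⁻¹q)`, so the
condition `Λ(q) = 0` becomes `Λ(αq) = 0`. -/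
theorem sameOrbit_covec_comp_mulLeft {α : ℍ[ℝ]} (hα : α ≠ 0) (Λ : ℍ[ℝ] →ₗ[ℝ] ℂ) :
    SameOrbit (kappaLin (covec 0 Λ)) (kappaLin (covec 0 (Λ.comp (LinearMap.mulLeft ℝ α)))) := by
  obtain ⟨T, hT, e⟩ := exists_mem_GL2H
    (show quatMatrix α 0 0 1 * quatMatrix α⁻¹ 0 0 1 = 1 by
      rw [quatMatrix_mul, ← quatMatrix_one]; simp [hα])
  refine ⟨T, hT, 1, one_ne_zero, ?_⟩
  rw [e, one_smul, wedgeMap_apply, comp_mulLeft_eq_ofCoef, kappaLin_covec_zero_ofCoef]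
  funext k
  fin_cases k <;>
    simp [quatMatrix, fstC_one, sndC_one, fstC_zero, sndC_zero, kappaLin, covec, wedge,
      Matrix.col] <;> ring

/-- The map `q ↦ Re q + i λ Re (u q)`. -/
noncomputable def normalMap (l : ℝ) (u : ℍ[ℝ]) : ℍ[ℝ] →ₗ[ℝ] ℂ where
  toFun q := q.re + Complex.I * l * (u * q).re
  map_add' x y := by
    rw [mul_add, Quaternion.re_add, Quaternion.re_add]
    push_cast
    ring
  map_smul' c x := by
    rw [mul_smul_comm, Quaternion.re_smul, Quaternion.re_smul, RingHom.id_apply, Complex.real_smul]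
    simp only [smul_eq_mul]
    push_cast
    ring

theorem normalMap_apply (l : ℝ) (u q : ℍ[ℝ]) :
    normalMap l u q = q.re + Complex.I * l * (u * q).re := rfl

/-- On graphs of quaternions, `poleVec l` is the pole of `|q|² - 1 - 2iλ Re q = 0`. The Cayley
transform `Φ ↦ (1 - UΦ)(1 + UΦ)⁻¹`, with `U` the block of `u`, carries the unit sphere to `Re q = 0`
and `Re q = 0` to `Re(uq) = 0`. -/
theorem sameOrbit_normalMap (l : ℝ) {u : ℍ[ℝ]} (hre : u.re = 0) (hu : u * u = -1) :
    SameOrbit (poleVec l) (kappaLin (covec 0 (normalMap l u))) := by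
  have h2 : ((1 / 2 : ℝ) : ℍ[ℝ]) + ((1 / 2 : ℝ) : ℍ[ℝ]) = 1 := by
    rw [← Quaternion.coe_add]; norm_num
  obtain ⟨T, hT, e⟩ := exists_mem_GL2H
    (show quatMatrix 1 u 1 (-u) * quatMatrix ((1 / 2 : ℝ) : ℍ[ℝ]) ((1 / 2 : ℝ) : ℍ[ℝ])
        (-(((1 / 2 : ℝ) : ℍ[ℝ]) * u)) (((1 / 2 : ℝ) : ℍ[ℝ]) * u) = 1 by
      rw [quatMatrix_mul, ← quatMatrix_one]
      simp only [mul_one, neg_mul, mul_neg, neg_neg, mul_assoc, hu]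
      rw [h2]
      simp)
  -- The matrix sends `E₆ - E₁` to `2(E₄ - E₃)`, whereas the pole of `q ↦ Re q` is `(E₃ - E₄)/2`;
  -- this gives the factor `-4`.
  refine ⟨T, hT, -4, by norm_num, ?_⟩
  have hsq : u.imI ^ 2 + u.imJ ^ 2 + u.imK ^ 2 = 1 := by
    have := congrArg QuaternionAlgebra.re hu
    simp [hre] at this
    linarith
  rw [e, wedgeMap_apply]
  funext k
  fin_cases k <;> apply Complex.ext <;>
    simp [quatMatrix, kappaLin, covec, wedge,
      Matrix.col, coef2, coef3, coef4, coef5, normalMap_apply, poleVec, qi_parts, qj_parts, qk_parts,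
      fstC, sndC, hre] <;> linarith

/-! ### Classification of the maps `Λ` -/

theorem re_star_mul (p q : ℍ[ℝ]) :
    (star p * q).re = p.re * q.re + p.imI * q.imI + p.imJ * q.imJ + p.imK * q.imK := by
  simp

/-- An `ℝ`-linear map `ℍ → ℂ` is `q ↦ ⟨x, q⟩ + i ⟨y, q⟩`. -/
theorem exists_apply_eq_re (Λ : ℍ[ℝ] →ₗ[ℝ] ℂ) : ∃ x y : ℍ[ℝ],
    (∀ q, Λ q = ((star x * q).re : ℂ) + Complex.I * ((star y * q).re : ℂ)) ∧
    -4 * Delta Λ = ((star x * x).re - (star y * y).re : ℝ) + 2 * Complex.I * (star y * x).re := by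
  obtain ⟨x, x0, x1, x2, x3⟩ : ∃ x : ℍ[ℝ], x.re = (Λ 1).re ∧ x.imI = (Λ qi).re ∧
      x.imJ = (Λ qj).re ∧ x.imK = (Λ qk).re := ⟨⟨_, _, _, _⟩, rfl, rfl, rfl, rfl⟩
  obtain ⟨y, y0, y1, y2, y3⟩ : ∃ y : ℍ[ℝ], y.re = (Λ 1).im ∧ y.imI = (Λ qi).im ∧
      y.imJ = (Λ qj).im ∧ y.imK = (Λ qk).im := ⟨⟨_, _, _, _⟩, rfl, rfl, rfl, rfl⟩
  refine ⟨x, y, fun q => ?_, ?_⟩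
  · rw [apply_eq_coef, re_star_mul, re_star_mul, x0, x1, x2, x3, y0, y1, y2, y3]
    apply Complex.ext <;> simp [coef2, coef3, coef4, coef5, fstC, sndC] <;> ring
  -- Up to the factor `-4`, `Δ` is the complex bilinear square of `x + iy`.
  · rw [re_star_mul, re_star_mul, re_star_mul, x0, x1, x2, x3, y0, y1, y2, y3]
    apply Complex.ext <;> simp [Delta, coef2, coef3, coef4, coef5] <;> ring

theorem Delta_smul (c : ℂ) (Λ : ℍ[ℝ] →ₗ[ℝ] ℂ) : Delta (c • Λ) = c ^ 2 * Delta Λ := by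
  simp only [Delta, coef2, coef3, coef4, coef5, LinearMap.smul_apply, smul_eq_mul]
  ring

/-- If `s² = B`, then `θ = s̄` gives `θ²B = |s|⁴`. With `B = -4Δ(Λ)`, rescaling `Λ` by `θ` makes `x`
and `y` orthogonal with `|x| ≥ |y|`. -/
theorem exists_sq_mul_eq_ofReal (B : ℂ) : ∃ θ : ℂ, θ ≠ 0 ∧ ∃ r : ℝ, 0 ≤ r ∧ θ ^ 2 * B = r := by
  rcases eq_or_ne B 0 with rfl | hB
  · exact ⟨1, one_ne_zero, 0, le_rfl, by simp⟩
  · obtain ⟨s, hs⟩ := IsAlgClosed.exists_pow_nat_eq B (n := 2) two_pos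
    have hs0 : s ≠ 0 := by
      rintro rfl
      exact hB (by rw [← hs]; simp)
    refine ⟨star s, by simpa using hs0, Complex.normSq s ^ 2, by positivity, ?_⟩
    rw [← hs, ← mul_pow, Complex.star_def, ← Complex.normSq_eq_conj_mul_self]
    push_cast
    rfl

theorem re_star_mul_self_pos {q : ℍ[ℝ]} (hq : q ≠ 0) : 0 < (star q * q).re := by
  rw [Quaternion.star_mul_self, Quaternion.re_coe]
  exact lt_of_le_of_ne Quaternion.normSq_nonneg (Quaternion.normSq_ne_zero.2 hq).symm

theorem sameOrbit_covec_of_smul {p : Fin 6 → ℂ} {c : ℂ} (hc : c ≠ 0) {Λ : ℍ[ℝ] →ₗ[ℝ] ℂ} (a₀ : ℍ[ℝ])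
    (h : SameOrbit p (kappaLin (covec 0 (c • Λ)))) : SameOrbit p (kappaLin (covec a₀ Λ)) := by
  rw [map_smul, map_smul] at h
  exact (h.trans (sameOrbit_smul hc _)).trans (sameOrbit_covec a₀ Λ)

/-- Left multiplication by `x` brings `⟨x, ·⟩ + i ⟨y, ·⟩` to its normal form. -/
theorem sameOrbit_of_comp_mulLeft_eq {l : ℝ} {u x : ℍ[ℝ]} (hre : u.re = 0) (hu : u * u = -1)
    (hx : x ≠ 0) {c : ℂ} (hc : c ≠ 0) {Λ : ℍ[ℝ] →ₗ[ℝ] ℂ}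
    (h : Λ.comp (LinearMap.mulLeft ℝ x) = c • normalMap l u) :
    SameOrbit (poleVec l) (kappaLin (covec 0 Λ)) := by
  have h1 := sameOrbit_covec_comp_mulLeft hx Λ
  rw [h, map_smul, map_smul] at h1
  exact (sameOrbit_normalMap l hre hu).trans ((h1.trans (sameOrbit_smul hc _)).symm)

/-- Dividing by a generator `c` of the image makes `Λ` real, hence of the form `⟨x,·⟩`; left
multiplication by `x` turns it into `|x|² Re`, the normal form with `λ = 0`. -/
theorem sameOrbit_minusVec {Λ : ℍ[ℝ] →ₗ[ℝ] ℂ} (a₀ : ℍ[ℝ])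
    (hrank : Module.finrank ℝ (LinearMap.range Λ) = 1) :
    SameOrbit minusVec (kappaLin (covec a₀ Λ)) := by
  obtain ⟨⟨c, hcr⟩, hc1, hc⟩ := finrank_eq_one_iff'.1 hrank
  have hc0 : c ≠ 0 := fun h => hc1 (Subtype.ext h)
  have hreal : ∀ q, ∃ t : ℝ, (c⁻¹ • Λ) q = t := by
    intro q
    obtain ⟨t, ht⟩ := hc ⟨Λ q, LinearMap.mem_range_self Λ q⟩
    refine ⟨t, ?_⟩
    have ht : t • c = Λ q := congrArg Subtype.val ht
    rw [LinearMap.smul_apply, ← ht, Complex.real_smul, smul_eq_mul]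
    field_simp
  obtain ⟨x, y, hxy, -⟩ := exists_apply_eq_re (c⁻¹ • Λ)
  have hx : ∀ q, (c⁻¹ • Λ) q = (star x * q).re := by
    intro q
    obtain ⟨t, ht⟩ := hreal q
    have := hxy q
    rw [ht] at this
    have h2 := congrArg Complex.re this
    simp only [Complex.ofReal_re, Complex.add_re, Complex.mul_re, Complex.I_re, Complex.I_im,
      Complex.ofReal_im, zero_mul, mul_zero, sub_self, add_zero] at h2
    rw [ht, h2]
  have hx0 : x ≠ 0 := by
    rintro rfl
    obtain ⟨q, hq⟩ := hcr
    have := hx q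
    rw [LinearMap.smul_apply, hq, smul_eq_mul, inv_mul_cancel₀ hc0] at this
    simp at this
  have hpos := re_star_mul_self_pos hx0
  have hsign : SameOrbit minusVec (poleVec 0) := by
    have : minusVec = (-1 : ℂ) • poleVec 0 := by
      funext k
      fin_cases k <;> simp [minusVec, poleVec]
    rw [this]
    exact sameOrbit_smul (by norm_num) _
  -- For `λ = 0` the unit `u` drops out of the normal form; `qi` is an arbitrary choice.
  refine hsign.trans (sameOrbit_covec_of_smul (inv_ne_zero hc0) a₀
    (sameOrbit_of_comp_mulLeft_eq (u := qi) qi_parts.1 ?_ hx0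
      (Complex.ofReal_ne_zero.2 hpos.ne') ?_))
  · ext <;> simp [qi_parts]
  · refine LinearMap.ext fun q => ?_
    rw [LinearMap.comp_apply, hx, LinearMap.smul_apply, normalMap_apply, LinearMap.mulLeft_apply,
      ← mul_assoc, Quaternion.star_mul_self, Quaternion.re_coe, Quaternion.coe_mul_eq_smul,
      Quaternion.re_smul]
    simp

/-- After rescaling by `θ`, the vectors `x` and `y` are orthogonal with `|x|² = |y|² + r`, and `λ`
is the ratio `|y|/|x|`. It equals `1` only if `r = 0`, that is, if `Δ` vanishes. -/
theorem exists_sameOrbit_poleVec {Λ : ℍ[ℝ] →ₗ[ℝ] ℂ} (a₀ : ℍ[ℝ])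
    (hrank : Module.finrank ℝ (LinearMap.range Λ) = 2) :
    ∃ l : ℝ, 0 < l ∧ l ≤ 1 ∧ (l = 1 ↔ Delta Λ = 0) ∧
      SameOrbit (poleVec l) (kappaLin (covec a₀ Λ)) := by
  obtain ⟨θ, hθ, r, hr, hB⟩ := exists_sq_mul_eq_ofReal (-4 * Delta Λ)
  obtain ⟨x, y, hxy, hD⟩ := exists_apply_eq_re (θ • Λ)
  rw [Delta_smul, show -4 * (θ ^ 2 * Delta Λ) = θ ^ 2 * (-4 * Delta Λ) by ring, hB] at hD
  have hnorm : (star x * x).re = (star y * y).re + r := by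
    have := congrArg Complex.re hD
    simp only [Complex.ofReal_re, Complex.add_re, Complex.mul_re, Complex.mul_im, Complex.I_re, Complex.I_im,
      Complex.ofReal_im, Complex.re_ofNat, Complex.im_ofNat] at this
    linarith
  have horth : (star y * x).re = 0 := by
    have := congrArg Complex.im hD
    simp only [Complex.ofReal_re, Complex.add_im, Complex.mul_re, Complex.mul_im, Complex.I_re, Complex.I_im,
      Complex.ofReal_im, Complex.re_ofNat, Complex.im_ofNat] at this
    linarith
  have hy0 : y ≠ 0 := by
    rintro rfl
    -- If `y = 0`, then `θΛ` is real-valued and the image of `Λ` is at most a real line, against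
    -- rank 2.
    have hle : LinearMap.range Λ ≤ Submodule.span ℝ {θ⁻¹} := by
      rintro _ ⟨q, rfl⟩
      rw [Submodule.mem_span_singleton]
      refine ⟨(star x * q).re, ?_⟩
      have := hxy q
      rw [LinearMap.smul_apply, smul_eq_mul, star_zero, zero_mul, Quaternion.re_zero,
        Complex.ofReal_zero, mul_zero, add_zero] at this
      rw [Complex.real_smul, ← this]
      field_simp
    have h1 := Submodule.finrank_mono hle
    have h2 := finrank_span_singleton (K := ℝ) (inv_ne_zero hθ)
    omega
  have hY := re_star_mul_self_pos hy0
  have hX : 0 < (star x * x).re := by linarith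
  have hx0 : x ≠ 0 := by
    rintro rfl
    simp at hX
  set X := (star x * x).re with hXdef
  set Y := (star y * y).re with hYdef
  set l := √(Y / X) with hl
  have hl2 : l ^ 2 = Y / X := Real.sq_sqrt (by positivity)
  have hlpos : 0 < l := Real.sqrt_pos.2 (by positivity)
  have hl1 : l = 1 ↔ Delta Λ = 0 := by
    have e1 : l = 1 ↔ r = 0 := by
      rw [hl, Real.sqrt_eq_one, div_eq_one_iff_eq hX.ne']
      constructor <;> intro h <;> linarith
    have e2 : r = 0 ↔ Delta Λ = 0 := by
      rw [← Complex.ofReal_eq_zero, ← hB]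
      simp [hθ]
    rw [e1, e2]
  have hle : l ≤ 1 := by
    refine Real.sqrt_le_one.2 ((div_le_one hX).2 ?_)
    linarith
  refine ⟨l, hlpos, hle, hl1, sameOrbit_covec_of_smul hθ a₀ ?_⟩
  -- Composing with left multiplication by `x` gives `X Re q + i Re(ȳxq)`, so `u = ȳx/(λX)`. It is
  -- imaginary since `x ⟂ y`, and a unit since `|ȳx|² = XY = (λX)²`.
  have hre : ((l * X)⁻¹ • (star y * x)).re = 0 := by
    rw [Quaternion.re_smul, horth, smul_zero]
  refine sameOrbit_of_comp_mulLeft_eq (u := (l * X)⁻¹ • (star y * x)) hre ?_ hx0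
    (Complex.ofReal_ne_zero.2 hX.ne') ?_
  · have hstar : star (star y * x) = -(star y * x) :=
      Quaternion.star_eq_neg.2 horth
    have hsq : (star y * x) * (star y * x) = -((Y * X : ℝ) : ℍ[ℝ]) := by
      have h1 : Quaternion.normSq (star y * x) = Y * X := by
        rw [map_mul, Quaternion.normSq_star, hXdef, hYdef, Quaternion.star_mul_self,
          Quaternion.star_mul_self, Quaternion.re_coe, Quaternion.re_coe]
      rw [← h1, ← Quaternion.star_mul_self, hstar, neg_mul, neg_neg]
    rw [smul_mul_smul_comm, hsq, smul_neg, ← Quaternion.coe_mul_eq_smul, ← Quaternion.coe_mul]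
    have : (l * X)⁻¹ * (l * X)⁻¹ * (Y * X) = 1 := by
      rw [← mul_inv, show l * X * (l * X) = l ^ 2 * X ^ 2 by ring, hl2]
      field_simp
    rw [this, Quaternion.coe_one]
  · refine LinearMap.ext fun q => ?_
    rw [LinearMap.comp_apply, hxy, LinearMap.smul_apply, normalMap_apply, LinearMap.mulLeft_apply,
      ← mul_assoc, ← mul_assoc]
    have h1 : (star x * x * q).re = X * q.re := by
      rw [hXdef, Quaternion.star_mul_self, Quaternion.coe_mul_eq_smul, Quaternion.re_smul,
        Quaternion.re_coe, smul_eq_mul]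
    have hX' : (X : ℂ) ≠ 0 := Complex.ofReal_ne_zero.2 hX.ne'
    have hl' : (l : ℂ) ≠ 0 := Complex.ofReal_ne_zero.2 hlpos.ne'
    rw [h1, smul_mul_assoc, Quaternion.re_smul]
    simp only [smul_eq_mul]
    push_cast
    field_simp

end TwistorPoly

theorem theorem4 (Ω : Set ℍ[ℝ]) (hΩ : IsSymmetricSliceDomain Ω)
    (n : ℕ) (a : ℕ → ℍ[ℝ])
    (hconst : ¬ ∃ c, ∀ q, slicePoly n a q = c)
    (hplanar : IsPlanar Ω (slicePoly n a)) :
    -- the dimension `r` of `S_f` is at most `3`, and `ℙ(𝒜_f) ≅ ℂℙ^{3-r}`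
    Module.finrank ℝ (coeffSpan n a) ≤ 3 ∧
    ProjIso (annihilator (coeffSpan n a))
      (Fin (3 - Module.finrank ℝ (coeffSpan n a) + 1) → ℂ) ∧
    -- for every non-zero `Λ ∈ 𝒜_f`, the section of `z_{Λ,f}` contains `G_f`
    (∀ (Λ : ℍ[ℝ] →ₗ[ℝ] ℂ) (hΛ : Λ ≠ 0), Λ ∈ annihilator (coeffSpan n a) →
      LiesIn Ω (slicePoly n a) (covecClass (a 0) Λ hΛ)) ∧
    -- `[Λ] ↦ [z_{Λ,f}]` is a bijection from `ℙ(𝒜_f)` onto the hyperplanes whose section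
    -- contains `G_f`
    Set.BijOn (covecMap (a 0) (annihilator (coeffSpan n a))) Set.univ
      {z | LiesIn Ω (slicePoly n a) z} ∧
    -- `[Λ] ↦ X_{z_{Λ,f}}` is a bijection from `ℙ(𝒜_f)` onto the hyperplane sections
    -- containing `G_f`
    Set.BijOn
      (fun P => hyperplaneSection (covecMap (a 0) (annihilator (coeffSpan n a)) P)) Set.univ
      {X | X ∈ Set.range hyperplaneSection ∧
        twistor (slicePoly n a) '' upperSlice Ω ⊆ X} ∧
    -- the type of the section of `z_{Λ,f}`
    ∀ (Λ : ℍ[ℝ] →ₗ[ℝ] ℂ) (hΛ : Λ ≠ 0), Λ ∈ annihilator (coeffSpan n a) →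
      (Module.finrank ℝ (LinearMap.range Λ) = 1 →
        covecClass (a 0) Λ hΛ ∈ AMinus ∧ IsPlanarOfType Ω (slicePoly n a) AMinus) ∧
      (Module.finrank ℝ (LinearMap.range Λ) = 2 → Delta Λ = 0 →
        covecClass (a 0) Λ hΛ ∈ AQN ∧ IsPlanarOfType Ω (slicePoly n a) AQN) ∧
      (Module.finrank ℝ (LinearMap.range Λ) = 2 → Delta Λ ≠ 0 →
        covecClass (a 0) Λ hΛ ∈ ANd ∧ IsPlanarOfType Ω (slicePoly n a) ANd) := by
  have hlies : ∀ (Λ : ℍ[ℝ] →ₗ[ℝ] ℂ) (hΛ : Λ ≠ 0), Λ ∈ annihilator (coeffSpan n a) →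
      LiesIn Ω (slicePoly n a) (covecClass (a 0) Λ hΛ) := fun Λ hΛ hmem =>
    (liesIn_iff_exists_covec hΩ hconst _).2 ⟨Λ, hmem, rfl⟩
  have hr := finrank_coeffSpan_le hΩ hconst hplanar
  refine ⟨hr, projIso_annihilator hr, hlies, bijOn_covecMap hΩ hconst,
    bijOn_hyperplaneSection_covecMap hΩ hconst, fun Λ hΛ hmem => ?_⟩
  have htype : ∀ A, covecClass (a 0) Λ hΛ ∈ A →
      covecClass (a 0) Λ hΛ ∈ A ∧ IsPlanarOfType Ω (slicePoly n a) A :=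
    fun A hA => ⟨hA, _, hA, hlies Λ hΛ hmem⟩
  refine ⟨fun h1 => htype _ ?_, fun h2 hD => htype _ ?_, fun h2 hD => htype _ ?_⟩
  · exact mk_mem_kappa_image_orbit minusVec_ne_zero (covec_ne_zero hΛ) (sameOrbit_minusVec (a 0) h1)
  · obtain ⟨l, -, -, hl, h⟩ := exists_sameOrbit_poleVec (a 0) h2
    rw [hl.2 hD] at h
    exact mk_mem_kappa_image_orbit (poleVec_ne_zero 1) (covec_ne_zero hΛ) h
  · obtain ⟨l, hl0, hl1, hl, h⟩ := exists_sameOrbit_poleVec (a 0) h2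
    obtain ⟨p, hp, hpz⟩ := mk_mem_kappa_image_orbit (poleVec_ne_zero l) (covec_ne_zero hΛ) h
    -- Here `Δ(Λ) ≠ 0` excludes `λ = 1`, so `λ` lies in the open interval that indexes `ANd`.
    exact ⟨p, Set.mem_iUnion₂.2 ⟨l, ⟨hl0, lt_of_le_of_ne hl1 fun e => hD (hl.1 e)⟩, hp⟩, hpz⟩
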